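/- All matroids are finite. For a matroid $\mathsf M$ of rank $k$ on the ground set $E$, let $\mathscr L(\mathsf M)$ be its lattice of flats; for a flat $F$ let $\mathsf M^F$ be the restriction of $\mathsf M$ to $F$ and $\mathsf M_F$ the contraction of $\mathsf M$ by $F$. Let $\chi_{\mathsf M}(t)$ be the characteristic polynomial of $\mathscr L(\mathsf M)$, and let $P_{\mathsf M}(t)\in\mathbb Z[t]$ be the Kazhdan–Lusztig polynomial of $\mathsf M$: $P_{\mathsf M}=1$ if $E=\varnothing$, $P_{\mathsf M}=0$ if $\mathsf M$ has a loop, and, for loopless $\mathsf M$ of rank $k>0$, $\deg P_{\mathsf M}<k/2$ and $$t^{k}P_{\mathsf M}(t^{-1})=\sum_{F\in\mathscr L(\mathsf M)}\chi_{\mathsf M^F}(t)\,P_{\mathsf M_F}(t).$$ Let $Z_{\mathsf M}(t)=\sum_{F\in\mathscr L(\mathsf M)}t^{\operatorname{rk}(F)}P_{\mathsf M_F}(t)$, a palindromic polynomial of degree $k$. The $\gamma$-polynomial of $\mathsf M$ is $\gamma_{\mathsf M}(t)=\sum_{i=0}^{\lfloor k/2\rfloor}\gamma_i t^i$, where the integers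 $\gamma_i$ are determined by $Z_{\mathsf M}(t)=\sum_{i=0}^{\lfloor k/2\rfloor}\gamma_i\,t^i(1+t)^{k-2i}$. Let $\mathsf U_{k,n}$ be the uniform matroid of rank $k$ on $n$ elements. For $h\ge k\ge 1$ put $$g_{k,h}(t)=\gamma_{\mathsf U_{k,h+1}}(t)-\gamma_{\mathsf U_{k-1,h}}(t).$$ **Theorem.** (a) Let $\mathsf M$ be a paving matroid of rank $k$ on $n$ elements (every circuit has at least $k$ elements), and for each $h\ge k$ let $\lambda_h$ be the number of hyperplanes (flats of rank $k-1$) of $\mathsf M$ of cardinality $h$. Then $$\gamma_{\mathsf M}(t)=\gamma_{\mathsf U_{k,n}}(t)-\sum_{h\ge k}\lambda_h\,g_{k,h}(t).$$ (If $k=0$ there are no hyperplanes, and the sum is $0$.) (b) For all integers $h\ge k\ge 1$, the polynomial $g_{k,h}(t)$ has non-negative coefficients and degree $\lfloor k/2\rfloor$. (For $k=1$ it is the zero polynomial, whose degree is read as $0$ here.) -/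

import Mathlib

open Polynomial

namespace Matroid

variable {α : Type*}

/-! ### Rank, flats, hyperplanes, paving matroids -/

/-- The rank of a set, as a natural number (meaningful for finite matroids). -/
noncomputable def natRk (M : Matroid α) (A : Set α) : ℕ := (M.eRk A).toNat

/-- The rank of the matroid, as a natural number (meaningful for finite matroids). -/
noncomputable def natRank (M : Matroid α) : ℕ := M.natRk M.E

/-- The flats of `M`, partially ordered by inclusion. -/
abbrev Flats (M : Matroid α) : Type _ := {F : Set α // M.IsFlat F}

instance finite_flats (M : Matroid α) [M.Finite] : Finite M.Flats :=
  Set.Finite.subset M.ground_finite.finite_subsets (fun _ hF => hF.subset_ground)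

noncomputable instance fintypeFlats (M : Matroid α) [M.Finite] : Fintype M.Flats :=
  Fintype.ofFinite _

open Classical in
noncomputable instance locallyFiniteOrderFlats (M : Matroid α) [M.Finite] :
    LocallyFiniteOrder M.Flats :=
  Fintype.toLocallyFiniteOrder

/-- The least flat, consisting of the loops of `M`. -/
def botFlat (M : Matroid α) : M.Flats := ⟨M.closure ∅, isFlat_closure _⟩

/-- A hyperplane is a flat of rank `rk M - 1`. -/
def IsHyperplaneFlat (M : Matroid α) (H : Set α) : Prop :=
  M.IsFlat H ∧ M.eRk H + 1 = M.eRank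

/-- The number of hyperplanes of cardinality `h`. -/
noncomputable def numHyperplanes (M : Matroid α) (h : ℕ) : ℕ :=
  {H : Set α | M.IsHyperplaneFlat H ∧ H.encard = h}.ncard

/-- A matroid of rank `k` is paving if all its circuits have size at least `k`. -/
def IsPaving (M : Matroid α) : Prop := ∀ C, M.IsCircuit C → M.eRank ≤ C.encard

/-! ### Kazhdan--Lusztig polynomial and `Z`-polynomial -/

open Classical in
/-- The characteristic polynomial `∑_F μ(⊥, F) t ^ (rk M - rk F)` of the lattice of flats. -/
noncomputable def charPoly (M : Matroid α) [M.Finite] : ℤ[X] :=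
  ∑ F : M.Flats, C (IncidenceAlgebra.mu ℤ M.botFlat F) * X ^ (M.natRank - M.natRk F.1)

/-- The localization of `M` at the flat `F`. -/
def localization (M : Matroid α) (F : M.Flats) : Matroid α := M ↾ F.1

instance finite_localization (M : Matroid α) [M.Finite] (F : M.Flats) :
    (M.localization F).Finite :=
  restrict_finite (M.ground_finite.subset F.2.subset_ground)

lemma ncard_contract_lt (M : Matroid α) [M.Finite] (F : M.Flats) (hF : F.1 ≠ ∅) :
    (M ／ F.1).E.ncard < M.E.ncard := by
  refine Set.ncard_lt_ncard ?_ M.ground_finite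
  obtain ⟨e, he⟩ := Set.nonempty_iff_ne_empty.2 hF
  exact ⟨Set.sdiff_subset, fun h => (h (F.2.subset_ground he)).2 he⟩

open Classical in
/-- The Kazhdan--Lusztig polynomial of a finite matroid.

It is `1` for the empty matroid and `0` for a matroid with loops (in particular for a non-empty
matroid of rank `0`). For a non-empty loopless `M` of rank `k` it is the polynomial `P` of degree
`< k / 2` with `t ^ k * P (1 / t) = ∑_F χ_{M ↾ F} (t) * P_{M ／ F} (t)`, the sum being over all
flats `F`. The flat `F = ∅` contributes `P` itself and `t ^ k * P (1 / t)` has no terms of degree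
`≤ k / 2`, so for `i < k / 2` the `i`-th coefficient of `P` is minus that of the sum over the
non-empty flats; see `klPoly_unique` below. -/
noncomputable def klPoly (M : Matroid α) [M.Finite] : ℤ[X] :=
  if M.E = ∅ then 1
  else if M.Loopless then
    ∑ i ∈ (Finset.range M.natRank).filter (fun i => 2 * i < M.natRank),
      monomial i (-(∑ F : {F : M.Flats // F.1 ≠ ∅},
        (M.localization F.1).charPoly * (M ／ F.1.1).klPoly).coeff i)
  else 0
termination_by M.E.ncard
decreasing_by exact M.ncard_contract_lt F.1 F.2

/-- The `Z`-polynomial `∑_F t ^ rk F * P_{M ／ F} (t)`. -/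
noncomputable def zPoly (M : Matroid α) [M.Finite] : ℤ[X] :=
  ∑ F : M.Flats, X ^ M.natRk F.1 * (M ／ F.1).klPoly

end Matroid

/-! ### `γ`-polynomials -/

/-- The coefficients `γ_m` in `f = ∑ m, γ_m t ^ m (1 + t) ^ (d - 2 m)`, found by comparing the
coefficients of `t ^ m`. -/
noncomputable def gammaCoeff (f : ℤ[X]) (d : ℕ) (m : ℕ) : ℤ :=
  f.coeff m - ∑ i : Fin m, gammaCoeff f d i * ((d - 2 * i.1).choose (m - i.1) : ℤ)
termination_by m
decreasing_by exact i.2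

/-- The `γ`-polynomial of a palindromic polynomial `f` of degree `d`: the polynomial
`∑_{i ≤ d / 2} γ_i t ^ i` where `f = ∑_{i ≤ d / 2} γ_i t ^ i (1 + t) ^ (d - 2 i)`;
see `gammaPoly_expansion` and `gammaPoly_unique`. -/
noncomputable def gammaPoly (f : ℤ[X]) : ℤ[X] :=
  ∑ i ∈ Finset.range (f.natDegree / 2 + 1), monomial i (gammaCoeff f f.natDegree i)

/-- The `γ`-polynomial of a matroid. -/
noncomputable def Matroid.gamma {α : Type*} (M : Matroid α) [M.Finite] : ℤ[X] :=
  gammaPoly M.zPoly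

/-! ### Uniform matroids -/

/-- The uniform matroid `U_{k,n}` on `Fin n`, for `k ≤ n`: a set is independent if it has at most
`k` elements, so the bases are the sets with `k` elements. -/
def uniformMatroid (k n : ℕ) : Matroid (Fin n) :=
  (IndepMatroid.ofFinite (E := Set.univ) Set.finite_univ (fun I => I.ncard ≤ k)
    (by simp)
    (fun I J hJ hIJ => (Set.ncard_le_ncard hIJ J.toFinite).trans hJ)
    (fun I J _ hJ hIJ => by
      obtain ⟨e, heJ, heI⟩ := Set.exists_mem_notMem_of_ncard_lt_ncard hIJ
      exact ⟨e, heJ, heI, (Set.ncard_insert_le e I).trans (by omega)⟩)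
    (fun _ _ => Set.subset_univ _)).matroid

instance finite_uniformMatroid (k n : ℕ) : (uniformMatroid k n).Finite :=
  ⟨Set.toFinite _⟩

/-- The polynomial `g_{k,h} = γ_{U_{k,h+1}} - γ_{U_{k-1,h}}`, for `1 ≤ k ≤ h`. -/
noncomputable def gPoly (k h : ℕ) : ℤ[X] :=
  (uniformMatroid k (h + 1)).gamma - (uniformMatroid (k - 1) h).gamma

/-! ### The definitions have the expected defining properties -/

theorem uniformMatroid_isBase_iff {k n : ℕ} (hkn : k ≤ n) (B : Set (Fin n)) :
    (uniformMatroid k n).IsBase B ↔ B.ncard = k := by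
  have hI : ∀ I : Set (Fin n), (uniformMatroid k n).Indep I ↔ I.ncard ≤ k := fun I => Iff.rfl
  rw [Matroid.isBase_iff_maximal_indep, maximal_iff]
  simp only [hI]
  constructor
  · rintro ⟨h1, h2⟩
    by_contra hne
    have hlt : B.ncard < (Set.univ : Set (Fin n)).ncard := by
      rw [Set.ncard_univ, Nat.card_fin]; omega
    obtain ⟨e, -, he⟩ := Set.exists_mem_notMem_of_ncard_lt_ncard hlt
    have := h2 (y := insert e B) ((Set.ncard_insert_le e B).trans (by omega))
      (Set.subset_insert e B)
    exact he (this ▸ Set.mem_insert e B)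
  · rintro h
    exact ⟨h.le, fun S hS hBS => Set.eq_of_subset_of_ncard_le hBS (by omega) S.toFinite⟩

theorem gammaCoeff_eq (f : ℤ[X]) (d m : ℕ) :
    f.coeff m = ∑ i ∈ Finset.range (m + 1),
      gammaCoeff f d i * ((d - 2 * i).choose (m - i) : ℤ) := by
  rw [Finset.sum_range_succ, gammaCoeff.eq_def f d m,
    Fin.sum_univ_eq_sum_range (fun i => gammaCoeff f d i * ((d - 2 * i).choose (m - i) : ℤ)) m]
  simp

theorem coeff_X_pow_mul_one_add_X_pow (i e m : ℕ) :
    ((X : ℤ[X]) ^ i * (1 + X) ^ e).coeff m = if i ≤ m then (e.choose (m - i) : ℤ) else 0 := by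
  rw [coeff_X_pow_mul', coeff_one_add_X_pow]

theorem gammaPoly_coeff (f : ℤ[X]) (i : ℕ) : (gammaPoly f).coeff i =
    if i ≤ f.natDegree / 2 then gammaCoeff f f.natDegree i else 0 := by
  simp [gammaPoly, coeff_monomial]

/-- Every palindromic polynomial has the expansion that defines its `γ`-polynomial. -/
theorem gammaPoly_expansion (f : ℤ[X]) (hf : f.reflect f.natDegree = f) :
    f = ∑ i ∈ Finset.range (f.natDegree / 2 + 1),
      C ((gammaPoly f).coeff i) * (X ^ i * (1 + X) ^ (f.natDegree - 2 * i)) := by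
  set d := f.natDegree with hd
  set S := ∑ i ∈ Finset.range (d / 2 + 1),
      C ((gammaPoly f).coeff i) * (X ^ i * (1 + X) ^ (d - 2 * i)) with hS
  have hcS : ∀ m, S.coeff m = ∑ i ∈ Finset.range (d / 2 + 1),
      gammaCoeff f d i * if i ≤ m then ((d - 2 * i).choose (m - i) : ℤ) else 0 := by
    intro m
    rw [hS, finsetSum_coeff]
    refine Finset.sum_congr rfl fun i hi => ?_
    rw [coeff_C_mul, coeff_X_pow_mul_one_add_X_pow, gammaPoly_coeff, if_pos]
    have := Finset.mem_range.1 hi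
    omega
  have hlow : ∀ m, m ≤ d / 2 → f.coeff m = S.coeff m := by
    intro m hm
    rw [hcS, gammaCoeff_eq f d m,
      ← Finset.sum_subset (s₁ := Finset.range (m + 1)) (s₂ := Finset.range (d / 2 + 1))
      (Finset.range_subset_range.2 (by omega))]
    · refine Finset.sum_congr rfl fun i hi => ?_
      have := Finset.mem_range.1 hi
      rw [if_pos (by omega)]
    · intro i _ hi
      have : ¬ i < m + 1 := fun h => hi (Finset.mem_range.2 h)
      rw [if_neg (by omega), mul_zero]
  have hfsym : ∀ m, m ≤ d → f.coeff (d - m) = f.coeff m := by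
    intro m hm
    conv_rhs => rw [← hf, coeff_reflect, revAt_le hm]
  have hSsym : ∀ m, m ≤ d / 2 → S.coeff (d - m) = S.coeff m := by
    intro m hm
    rw [hcS, hcS]
    refine Finset.sum_congr rfl fun i hi => ?_
    have := Finset.mem_range.1 hi
    rw [if_pos (by omega)]
    split_ifs with him
    · rw [← Nat.choose_symm (n := d - 2 * i) (k := m - i) (by omega)]
      congr 3
      omega
    · rw [Nat.choose_eq_zero_of_lt (by omega)]
      simp
  ext m
  rcases le_or_gt m (d / 2) with h | h
  · exact hlow m h
  rcases le_or_gt m d with h' | h'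
  · have e : m = d - (d - m) := by omega
    rw [e, hfsym _ (by omega), hSsym _ (by omega)]
    exact hlow _ (by omega)
  · rw [coeff_eq_zero_of_natDegree_lt (hd ▸ h'), hcS]
    symm
    refine Finset.sum_eq_zero fun i hi => ?_
    have := Finset.mem_range.1 hi
    rw [if_pos (by omega), Nat.choose_eq_zero_of_lt (by omega)]
    simp

/-- The coefficients of such an expansion are those of the `γ`-polynomial. -/
theorem gammaPoly_unique (f : ℤ[X]) (c : ℕ → ℤ)
    (hc : f = ∑ i ∈ Finset.range (f.natDegree / 2 + 1),
      C (c i) * (X ^ i * (1 + X) ^ (f.natDegree - 2 * i))) :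
    ∀ i ≤ f.natDegree / 2, (gammaPoly f).coeff i = c i := by
  set d := f.natDegree with hd
  intro m
  induction m using Nat.strong_induction_on with
  | _ m ih =>
    intro hm
    have h1 := gammaCoeff_eq f d m
    have h2 : f.coeff m = ∑ i ∈ Finset.range (m + 1),
        c i * ((d - 2 * i).choose (m - i) : ℤ) := by
      rw [hc, finsetSum_coeff, ← Finset.sum_subset (s₁ := Finset.range (m + 1))
        (Finset.range_subset_range.2 (by omega))]
      · refine Finset.sum_congr rfl fun i hi => ?_
        have := Finset.mem_range.1 hi
        rw [coeff_C_mul, coeff_X_pow_mul_one_add_X_pow, if_pos (by omega)]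
      · intro i _ hi
        have : ¬ i < m + 1 := fun h => hi (Finset.mem_range.2 h)
        rw [coeff_C_mul, coeff_X_pow_mul_one_add_X_pow, if_neg (by omega), mul_zero]
    have h3 : ∀ i ∈ Finset.range m, gammaCoeff f d i * ((d - 2 * i).choose (m - i) : ℤ) =
        c i * ((d - 2 * i).choose (m - i) : ℤ) := by
      intro i hi
      have := Finset.mem_range.1 hi
      have h := ih i this (by omega)
      rw [gammaPoly_coeff, if_pos (by omega)] at h
      rw [h]
    rw [h1, Finset.sum_range_succ, Finset.sum_range_succ, Finset.sum_congr rfl h3] at h2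
    rw [gammaPoly_coeff, if_pos hm]
    simpa using h2

namespace Matroid

/-- Any assignment of polynomials with the characterizing properties of the Kazhdan--Lusztig
polynomials of matroids is the one defined above. -/
theorem klPoly_unique {α : Type*} (P : (M : Matroid α) → M.Finite → ℤ[X])
    (h_empty : ∀ (M : Matroid α) (hM : M.Finite), M.E = ∅ → P M hM = 1)
    (h_loops : ∀ (M : Matroid α) (hM : M.Finite), ¬ M.Loopless → P M hM = 0)
    (h_deg : ∀ (M : Matroid α) (hM : M.Finite), M.natRank ≠ 0 →
      2 * (P M hM).natDegree < M.natRank)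
    (h_rec : ∀ (M : Matroid α) (hM : M.Finite), M.Loopless →
      (P M hM).reflect M.natRank =
        ∑ F : M.Flats, (M.localization F).charPoly * P (M ／ F.1) inferInstance)
    (M : Matroid α) (hM : M.Finite) : P M hM = M.klPoly := by
  induction hn : M.E.ncard using Nat.strong_induction_on generalizing M with
  | _ n ih =>
  subst hn
  rw [klPoly]
  split_ifs with hE hl
  · exact h_empty M hM hE
  · have hcl : M.IsFlat ∅ := by
      have h := M.isFlat_closure ∅
      rwa [← Matroid.loops, M.loops_eq_empty] at h
    have hk : M.natRank ≠ 0 := by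
      intro h0
      have h1 : M.eRk M.E = 0 := by
        rcases ENat.toNat_eq_zero.1 h0 with h | h
        · exact h
        · exact absurd h (by rw [eRk_ground]; exact (eRank_ne_top_iff M).2 inferInstance)
      rw [eRk_eq_zero_iff, M.loops_eq_empty] at h1
      exact hE (Set.subset_empty_iff.1 h1)
    have hd := h_deg M hM hk
    have hr := h_rec M hM hl
    set b : M.Flats := ⟨∅, hcl⟩ with hb
    have hchar : (M.localization b).charPoly = 1 := by
      have hu : ∀ F : (M.localization b).Flats, F = (M.localization b).botFlat := by
        intro F
        have h : ∀ G : (M.localization b).Flats, G.1 = ∅ := fun G =>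
          Set.subset_empty_iff.1 G.2.subset_ground
        exact Subtype.ext ((h F).trans (h _).symm)
      have h0 : (M.localization b).natRank = 0 := by
        simp [natRank, natRk, localization, hb]
      rw [charPoly, Fintype.sum_eq_single (M.localization b).botFlat
        (fun F hF => absurd (hu F) hF)]
      simp [h0]
    have hcon : P (M ／ b.1) inferInstance = P M hM := by
      congr 1
      exact M.contract_empty
    have hsum : (P M hM).reflect M.natRank = P M hM + ∑ F : {F : M.Flats // F.1 ≠ ∅},
        (M.localization F.1).charPoly * (M ／ F.1.1).klPoly := by
      classical
      rw [hr, ← Finset.add_sum_erase _ _ (Finset.mem_univ b), hchar, one_mul, hcon]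
      congr 1
      rw [← Finset.sum_subtype (Finset.univ.erase b) (p := fun F : M.Flats => F.1 ≠ ∅)
        (f := fun F : M.Flats => (M.localization F).charPoly * (M ／ F.1).klPoly)]
      · refine Finset.sum_congr rfl fun F hF => ?_
        have hne : F.1 ≠ ∅ := fun h => (Finset.mem_erase.1 hF).1 (Subtype.ext h)
        rw [ih _ (M.ncard_contract_lt F hne) _ inferInstance rfl]
      · intro F
        simp [hb, Subtype.ext_iff]
    ext i
    rw [finsetSum_coeff]
    simp only [coeff_monomial]
    rw [Finset.sum_ite_eq']
    have hi := congrArg (fun p => p.coeff i) hsum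
    simp only [coeff_add, coeff_reflect] at hi
    split_ifs with h
    · have h2 := (Finset.mem_filter.1 h).2
      rw [revAt_le (by omega), coeff_eq_zero_of_natDegree_lt (by omega)] at hi
      linarith
    · refine coeff_eq_zero_of_natDegree_lt ?_
      by_contra h3
      exact h (Finset.mem_filter.2 ⟨Finset.mem_range.2 (by omega), by omega⟩)
  · exact h_loops M hM hl

end Matroid

/-
Both parts follow the relaxation of a stressed hyperplane. In a paving matroid of rank `k` the flats
of rank at most `k - 2` are exactly the sets of at most `k - 2` elements, and contracting one of
them leaves a paving matroid. So, inductively, `P_M` and `Z_M` arise from those of `U_{k,n}` by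
subtracting, for every hyperplane with `h ≥ k` elements, the correction for the relaxation of
`U_{k-1,h} ⊕ U_{1,1}` to `U_{k,h+1}`: the error in `P_M` equals the error in `Z_M`, hence is
palindromic of degree `k` without coefficients in degrees `≥ k / 2`, and vanishes. The correction of
`Z` is `Z_{U_{k,h+1}} - (1 + t) Z_{U_{k-1,h}}`, whose `γ`-polynomial is `g_{k,h}`.

For the positivity, binomial inversion turns the degree bound on `P` into a recursion in `k` for
the corrections of `Z` with `h - k = m` fixed. It is solved by
`[t ^ (l + 1)] g_{k,k+m} = ∑_{i ≤ m} binom(i + k - 1, i + 2 l + 1) D_l(i)` with polynomials `D_l`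
positive on `ℕ`. Indeed, for fixed `m` the coefficients of this solution are polynomials in `k`
of low degree with values `0` or `-1` at `k = 0, -1, …, -m`, and alternating binomial sums of
length `k + m + 1` annihilate such polynomials.
-/

namespace PavingMatroid

open scoped Matroid

/-! ### Finite differences of polynomials -/

theorem sum_neg_one_pow_choose_mul_eval_eq_zero {R : Type*} [CommRing R] {f : R[X]} {n : ℕ}
    (hf : f.natDegree < n) (x y : R) :
    ∑ i ∈ Finset.range (n + 1), (-1 : R) ^ i * (n.choose i : R) * f.eval (x + i * y) = 0 := by
  have hdeg : (f.comp (C y * X + C x)).natDegree < n :=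
    (natDegree_comp_le.trans
      (mul_le_of_le_one_right (Nat.zero_le _) natDegree_linear_le)).trans_lt hf
  have hdiff := congrFun (fwdDiff_iter_eq_zero_of_degree_lt hdeg) 0
  rw [fwdDiff_iter_eq_sum_shift] at hdiff
  have hsign : ∀ i ∈ Finset.range (n + 1), (-1 : R) ^ i * (n.choose i : R) * f.eval (x + i * y) =
      (-1) ^ n * (((-1 : ℤ) ^ (n - i) * (n.choose i : ℤ)) •
        (f.comp (C y * X + C x)).eval (0 + i • (1 : R))) := by
    intro i hi
    have hin : i ≤ n := Finset.mem_range_succ_iff.1 hi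
    rw [show (-1 : R) ^ i = (-1) ^ n * (-1) ^ (n - i) by
      rw [← pow_add]; exact neg_one_pow_congr (by grind)]
    simp only [eval_comp, eval_add, eval_mul, eval_C, eval_X, nsmul_eq_mul, mul_one, zero_add,
      zsmul_eq_mul, Int.cast_mul, Int.cast_pow, Int.cast_neg, Int.cast_one, Int.cast_natCast]
    rw [add_comm (y * (i : R)) x, mul_comm y]
    ring
  rw [Finset.sum_congr rfl hsign, ← Finset.mul_sum, hdiff, Pi.zero_apply, mul_zero]

/-! ### Counting dissections of polygons -/

/-- The binomial coefficient `binom(x, n)` as a polynomial in `x`. -/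
noncomputable def binomPoly (n : ℕ) : ℚ[X] := C ((n.factorial : ℚ)⁻¹) * descPochhammer ℚ n

theorem natDegree_binomPoly_le (n : ℕ) : (binomPoly n).natDegree ≤ n :=
  (natDegree_C_mul_le _ _).trans (descPochhammer_natDegree ℚ n).le

theorem eval_binomPoly_natCast (n N : ℕ) : (binomPoly n).eval (N : ℚ) = N.choose n := by
  rw [binomPoly, eval_C_mul, Nat.cast_choose_eq_descPochhammer_div, inv_mul_eq_div]

theorem eval_binomPoly_neg (n N : ℕ) :
    (binomPoly n).eval (-((N : ℚ) + 1)) = (-1) ^ n * ((N + n).choose n : ℚ) := by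
  have hneg : (descPochhammer ℚ n).eval (-((N : ℚ) + 1)) =
      (-1) ^ n * (ascPochhammer ℚ n).eval ((N : ℚ) + 1) := by
    have h := ascPochhammer_eval_neg_eq_descPochhammer ℚ (-((N : ℚ) + 1)) n
    rw [neg_neg] at h
    rw [h, ← mul_assoc, ← mul_pow, neg_one_mul, neg_neg, one_pow, one_mul]
  rw [binomPoly, eval_C_mul, hneg, Nat.cast_choose_eq_descPochhammer_div,
    descPochhammer_eval_eq_ascPochhammer, Nat.cast_add, add_sub_cancel_right]
  ring

/-- The polynomial in `m` whose value at a natural number `m` is the number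
`binom(m + l, l) binom(m + 2 l + 2, l) / (l + 1)` of ways to choose `l` pairwise non-crossing
diagonals of a convex `(m + l + 3)`-gon, by the Kirkman–Cayley formula. -/
noncomputable def dissectionPoly (l : ℕ) : ℚ[X] :=
  C (((l : ℚ) + 1)⁻¹) *
    ((binomPoly l).comp (X + C (l : ℚ)) * (binomPoly l).comp (X + C (2 * (l : ℚ) + 2)))

theorem natDegree_dissectionPoly_le (l : ℕ) : (dissectionPoly l).natDegree ≤ 2 * l := by
  refine (natDegree_C_mul_le _ _).trans (natDegree_mul_le.trans ?_)
  rw [natDegree_comp, natDegree_comp, natDegree_X_add_C, natDegree_X_add_C]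
  have := natDegree_binomPoly_le l
  omega

theorem eval_dissectionPoly (l : ℕ) (x : ℚ) : (dissectionPoly l).eval x =
    ((l : ℚ) + 1)⁻¹ * ((binomPoly l).eval (x + l) * (binomPoly l).eval (x + (2 * l + 2))) := by
  simp [dissectionPoly, eval_comp]

theorem eval_dissectionPoly_pos (l m : ℕ) : 0 < (dissectionPoly l).eval (m : ℚ) := by
  have h₁ : (0 : ℚ) < ((m + l).choose l : ℚ) := mod_cast Nat.choose_pos (by omega)
  have h₂ : (0 : ℚ) < ((m + (2 * l + 2)).choose l : ℚ) := mod_cast Nat.choose_pos (by omega)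
  have hcast : (m : ℚ) + (2 * l + 2) = ((m + (2 * l + 2) : ℕ) : ℚ) := by push_cast; rfl
  rw [eval_dissectionPoly, hcast,
    ← Nat.cast_add, eval_binomPoly_natCast, eval_binomPoly_natCast]
  positivity

theorem eval_dissectionPoly_sub {l y : ℕ} (hy : y ≤ 2 * l) :
    (dissectionPoly l).eval ((y : ℚ) - (2 * l + 1)) =
      if y = l ∨ y + 1 = l then (-1) ^ l else 0 := by
  have hsnd : (binomPoly l).eval ((y : ℚ) - (2 * l + 1) + (2 * l + 2)) = (y + 1).choose l := by
    rw [← eval_binomPoly_natCast]; push_cast; ring_nf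
  rw [eval_dissectionPoly, hsnd]
  rcases le_or_gt y l with hyl | hly
  · have hfst : (binomPoly l).eval ((y : ℚ) - (2 * l + 1) + l) =
        (-1) ^ l * ((l - y + l).choose l : ℚ) := by
      rw [← eval_binomPoly_neg, Nat.cast_sub hyl]; ring_nf
    rw [hfst]
    rcases (by omega : y = l ∨ y + 1 = l ∨ y + 1 < l) with rfl | rfl | hlt
    · rw [if_pos (Or.inl rfl), Nat.sub_self, zero_add, Nat.choose_self, Nat.choose_succ_self_right]
      push_cast
      field_simp
    · rw [if_pos (Or.inr rfl), show y + 1 - y + (y + 1) = y + 1 + 1 by omega,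
        Nat.choose_succ_self_right, Nat.choose_self]
      push_cast
      field_simp
    · rw [if_neg (by omega), Nat.choose_eq_zero_of_lt hlt, Nat.cast_zero, mul_zero, mul_zero]
  · have hfst : (binomPoly l).eval ((y : ℚ) - (2 * l + 1) + l) = ((y - l - 1).choose l : ℚ) := by
      rw [← eval_binomPoly_natCast, Nat.sub_sub, Nat.cast_sub hly]; push_cast; ring_nf
    rw [hfst, if_neg (by omega), Nat.choose_eq_zero_of_lt (by omega), Nat.cast_zero, zero_mul,
      mul_zero]

theorem sum_neg_one_pow_choose_mul_dissectionPoly_sub (l N : ℕ) :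
    ∑ y ∈ Finset.range (2 * l + 1), (-1 : ℚ) ^ y * (N.choose y : ℚ) *
        (dissectionPoly l).eval ((y : ℚ) - (2 * l + 1)) =
      (N.choose l : ℚ) - if l = 0 then 0 else (N.choose (l - 1) : ℚ) := by
  have hterm : ∀ y ∈ Finset.range (2 * l + 1), (-1 : ℚ) ^ y * (N.choose y : ℚ) *
      (dissectionPoly l).eval ((y : ℚ) - (2 * l + 1)) =
      (if y = l then (N.choose l : ℚ) else 0) -
        if y + 1 = l then (N.choose (l - 1) : ℚ) else 0 := by
    intro y hy
    rw [eval_dissectionPoly_sub (Finset.mem_range_succ_iff.1 hy)]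
    rcases (by omega : y = l ∨ y + 1 = l ∨ (y ≠ l ∧ y + 1 ≠ l)) with rfl | rfl | ⟨h, h'⟩
    · rw [if_pos (Or.inl rfl), mul_right_comm, ← mul_pow]
      simp
    · rw [if_pos (Or.inr rfl), pow_succ, mul_neg_one, mul_neg, mul_right_comm, ← mul_pow]
      simp
    · simp [h, h']
  rw [Finset.sum_congr rfl hterm, Finset.sum_sub_distrib, Finset.sum_ite_eq',
    if_pos (Finset.mem_range.2 (by omega))]
  rcases l with _ | l
  · simp
  · simp only [add_left_inj, Nat.succ_ne_zero, if_false, Nat.add_sub_cancel, Finset.sum_ite_eq']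
    rw [if_pos (Finset.mem_range.2 (by omega))]

theorem cast_choose_sub_choose_pred (l r : ℕ) :
    (((r + 2 * l + 1).choose l : ℚ) - if l = 0 then 0 else ((r + 2 * l + 1).choose (l - 1) : ℚ)) =
      (r + 2) * (r + 2 * l + 1).factorial / (l.factorial * (r + l + 2).factorial) := by
  rcases l with _ | l
  · simp only [mul_zero, add_zero, Nat.choose_zero_right, Nat.cast_one, if_true, sub_zero,
      Nat.factorial_zero, Nat.factorial_succ (r + 1)]
    push_cast
    field_simp
    ring
  · rw [if_neg l.succ_ne_zero, Nat.add_sub_cancel, Nat.cast_choose ℚ (by omega),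
      Nat.cast_choose ℚ (by omega), show r + 2 * (l + 1) + 1 - (l + 1) = r + l + 2 by omega,
      show r + 2 * (l + 1) + 1 - l = r + l + 2 + 1 by omega,
      show r + (l + 1) + 2 = r + l + 2 + 1 by omega, Nat.factorial_succ l,
      Nat.factorial_succ (r + l + 2)]
    push_cast
    field_simp
    ring

theorem sum_neg_one_pow_choose_mul_dissectionPoly (l r : ℕ) :
    ∑ m ∈ Finset.range (r + 1), (-1 : ℚ) ^ m * ((r + 2 * l + 1).choose (r - m) : ℚ) *
        (dissectionPoly l).eval (m : ℚ) =
      (r + 2) * (r + 2 * l + 1).factorial / (l.factorial * (r + l + 2).factorial) := by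
  have hzero := sum_neg_one_pow_choose_mul_eval_eq_zero (f := dissectionPoly l)
    (n := r + 2 * l + 1) ((natDegree_dissectionPoly_le l).trans_lt (by omega)) (-(2 * l + 1)) 1
  simp only [mul_one, neg_add_eq_sub] at hzero
  rw [show r + 2 * l + 1 + 1 = (2 * l + 1) + (r + 1) by ring, Finset.sum_range_add,
    sum_neg_one_pow_choose_mul_dissectionPoly_sub, cast_choose_sub_choose_pred] at hzero
  rw [eq_comm, ← sub_eq_zero, ← hzero, sub_eq_add_neg, ← Finset.sum_neg_distrib]
  congr 1
  refine Finset.sum_congr rfl fun m hm => ?_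
  have hmr := Finset.mem_range.1 hm
  rw [Nat.choose_symm_of_eq_add (show r + 2 * l + 1 = (2 * l + 1 + m) + (r - m) by omega),
    Nat.cast_add (2 * l + 1) m, show ((2 * l + 1 : ℕ) : ℚ) + m - (2 * l + 1) = m by push_cast; ring,
    pow_add, Odd.neg_one_pow ⟨l, rfl⟩]
  ring

/-! ### The candidate for the coefficients of `g_{k,h}` -/

/-- The number that turns out to be the coefficient of `t ^ (l + 1)` in `g_{k, k + m}`, that is, in
the change of the `γ`-polynomial when a stressed hyperplane with `k + m` elements is relaxed. -/
noncomputable def relaxGamma (l m k : ℕ) : ℚ :=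
  ∑ i ∈ Finset.range (m + 1),
    ((i + k - 1).choose (i + 2 * l + 1) : ℚ) * (dissectionPoly l).eval (i : ℚ)

theorem relaxGamma_nonneg (l m k : ℕ) : 0 ≤ relaxGamma l m k :=
  Finset.sum_nonneg fun i _ => mul_nonneg (Nat.cast_nonneg _) (eval_dissectionPoly_pos l i).le

theorem relaxGamma_pos {l k : ℕ} (m : ℕ) (hk : 2 * l + 2 ≤ k) : 0 < relaxGamma l m k :=
  Finset.sum_pos (fun i _ => mul_pos (mod_cast Nat.choose_pos (by omega))
    (eval_dissectionPoly_pos l i)) Finset.nonempty_range_add_one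

theorem relaxGamma_eq_zero {l k : ℕ} (m : ℕ) (hk : 1 ≤ k) (hkl : k < 2 * l + 2) :
    relaxGamma l m k = 0 :=
  Finset.sum_eq_zero fun i _ => by
    rw [Nat.choose_eq_zero_of_lt (by omega), Nat.cast_zero, zero_mul]

/-- For fixed `l` and `m`, the number `relaxGamma l m k` as a polynomial in `k`. -/
noncomputable def relaxGammaPoly (l m : ℕ) : ℚ[X] :=
  ∑ i ∈ Finset.range (m + 1), C ((dissectionPoly l).eval (i : ℚ)) *
    (binomPoly (i + 2 * l + 1)).comp (X + C ((i : ℚ) - 1))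

theorem natDegree_relaxGammaPoly_le (l m : ℕ) : (relaxGammaPoly l m).natDegree ≤ m + 2 * l + 1 := by
  refine natDegree_sum_le_of_forall_le _ _ fun i hi => (natDegree_C_mul_le _ _).trans ?_
  have him := Finset.mem_range_succ_iff.1 hi
  rw [natDegree_comp, natDegree_X_add_C, mul_one]
  exact (natDegree_binomPoly_le _).trans (by omega)

theorem eval_relaxGammaPoly (l m : ℕ) (x : ℚ) : (relaxGammaPoly l m).eval x =
    ∑ i ∈ Finset.range (m + 1), (dissectionPoly l).eval (i : ℚ) *
      (binomPoly (i + 2 * l + 1)).eval (x + (i - 1)) := by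
  simp [relaxGammaPoly, eval_finsetSum, eval_comp]

theorem eval_relaxGammaPoly_natCast {l m k : ℕ} (hk : 1 ≤ k) :
    (relaxGammaPoly l m).eval (k : ℚ) = relaxGamma l m k := by
  rw [eval_relaxGammaPoly, relaxGamma]
  refine Finset.sum_congr rfl fun i _ => ?_
  rw [show (k : ℚ) + (i - 1) = ((i + k - 1 : ℕ) : ℚ) by
    rw [Nat.cast_sub (by omega)]; push_cast; ring, eval_binomPoly_natCast, mul_comm]

theorem eval_relaxGammaPoly_neg {l m r : ℕ} (hr : r ≤ m) : (relaxGammaPoly l m).eval (-(r : ℚ)) =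
    -((r + 2) * (r + 2 * l + 1).factorial / (l.factorial * (r + l + 2).factorial)) := by
  rw [← sum_neg_one_pow_choose_mul_dissectionPoly, eval_relaxGammaPoly, ← Finset.sum_neg_distrib,
    ← Finset.sum_subset (Finset.range_subset_range.2 (Nat.succ_le_succ hr))]
  · refine Finset.sum_congr rfl fun i hi => ?_
    have hir := Finset.mem_range_succ_iff.1 hi
    rw [show -(r : ℚ) + (i - 1) = -(((r - i : ℕ) : ℚ) + 1) by rw [Nat.cast_sub hir]; ring,
      eval_binomPoly_neg, show r - i + (i + 2 * l + 1) = r + 2 * l + 1 by omega,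
      Nat.choose_symm_of_eq_add (show r + 2 * l + 1 = (i + 2 * l + 1) + (r - i) by omega),
      add_assoc, pow_add _ i, Odd.neg_one_pow ⟨l, rfl⟩]
    ring
  · intro i _ hi
    have hri : r + 1 ≤ i := by simpa using hi
    rw [show -(r : ℚ) + (i - 1) = ((i - (r + 1) : ℕ) : ℚ) by
      rw [Nat.cast_sub hri]; push_cast; ring, eval_binomPoly_natCast,
      Nat.choose_eq_zero_of_lt (by omega), Nat.cast_zero, mul_zero]

/-- The polynomial with `γ`-coefficients `relaxGamma l m k`, which turns out to be the change of the
`Z`-polynomial when a stressed hyperplane with `k + m` elements is relaxed. -/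
noncomputable def relaxZClosed (m k : ℕ) : ℚ[X] :=
  ∑ l ∈ Finset.range (k / 2), C (relaxGamma l m k) * (X ^ (l + 1) * (1 + X) ^ (k - 2 * (l + 1)))

theorem coeff_zero_relaxZClosed (m k : ℕ) : (relaxZClosed m k).coeff 0 = 0 := by
  simp [relaxZClosed, finsetSum_coeff, mul_coeff_zero]

theorem coeff_succ_relaxZClosed {k : ℕ} (m c : ℕ) (hk : 1 ≤ k) :
    (relaxZClosed m k).coeff (c + 1) = ∑ l ∈ Finset.range (c + 1),
      relaxGamma l m k * ((k - (2 * l + 2)).choose (c - l) : ℚ) := by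
  have hcoeff : ∀ l, (C (relaxGamma l m k) *
      (X ^ (l + 1) * (1 + X) ^ (k - 2 * (l + 1)))).coeff (c + 1) =
      if l < c + 1 then relaxGamma l m k * ((k - (2 * l + 2)).choose (c - l) : ℚ) else 0 := by
    intro l
    rw [coeff_C_mul, coeff_X_pow_mul', coeff_one_add_X_pow, Nat.add_sub_add_right]
    split_ifs <;> grind
  rw [relaxZClosed, finsetSum_coeff, Finset.sum_congr rfl fun l _ => hcoeff l, ← Finset.sum_filter]
  refine Finset.sum_subset (fun l hl => Finset.mem_range.2 (Finset.mem_filter.1 hl).2)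
    fun l hl hlk => ?_
  have hkl : k < 2 * l + 2 := by
    simp only [Finset.mem_filter, Finset.mem_range] at hl hlk
    omega
  rw [relaxGamma_eq_zero m hk hkl, zero_mul]

/-- For fixed `m` and `c`, the coefficient of `t ^ (c + 1)` in `relaxZClosed m k` as a polynomial
in `k`. -/
noncomputable def relaxZCoeffPoly (m c : ℕ) : ℚ[X] :=
  ∑ l ∈ Finset.range (c + 1),
    relaxGammaPoly l m * (binomPoly (c - l)).comp (X - C (2 * (l : ℚ) + 2))

theorem natDegree_relaxZCoeffPoly_le (m c : ℕ) :
    (relaxZCoeffPoly m c).natDegree ≤ m + 2 * c + 1 := by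
  refine natDegree_sum_le_of_forall_le _ _ fun l hl => natDegree_mul_le.trans ?_
  have hlc := Finset.mem_range_succ_iff.1 hl
  have hrelax := natDegree_relaxGammaPoly_le l m
  have hbinom := natDegree_binomPoly_le (c - l)
  rw [natDegree_comp, natDegree_X_sub_C, mul_one]
  omega

theorem eval_relaxZCoeffPoly (m c : ℕ) (x : ℚ) : (relaxZCoeffPoly m c).eval x =
    ∑ l ∈ Finset.range (c + 1),
      (relaxGammaPoly l m).eval x * (binomPoly (c - l)).eval (x - (2 * l + 2)) := by
  simp [relaxZCoeffPoly, eval_finsetSum, eval_comp]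

theorem eval_relaxZCoeffPoly_natCast {m c k : ℕ} (hk : 1 ≤ k) :
    (relaxZCoeffPoly m c).eval (k : ℚ) = (relaxZClosed m k).coeff (c + 1) := by
  rw [eval_relaxZCoeffPoly, coeff_succ_relaxZClosed m c hk]
  refine Finset.sum_congr rfl fun l _ => ?_
  rw [eval_relaxGammaPoly_natCast hk]
  rcases lt_or_ge k (2 * l + 2) with h | h
  · rw [relaxGamma_eq_zero m hk h, zero_mul, zero_mul]
  · rw [show (k : ℚ) - (2 * l + 2) = ((k - (2 * l + 2) : ℕ) : ℚ) by
      rw [Nat.cast_sub h]; push_cast; ring, eval_binomPoly_natCast]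

theorem sum_neg_one_pow_choose_mul_factorial_div (r c : ℕ) :
    ∑ l ∈ Finset.range (c + 1), (-1 : ℚ) ^ l * (c.choose l : ℚ) *
        (((r + c + l + 1).factorial : ℚ) / (r + l + 2).factorial) =
      if c = 0 then 1 / ((r : ℚ) + 2) else 0 := by
  rcases c with _ | c
  · simp only [zero_add, add_zero, Finset.sum_range_one, pow_zero, Nat.choose_self, Nat.cast_one,
      mul_one, one_mul, if_true, Nat.factorial_succ (r + 1)]
    push_cast
    field_simp
    ring
  · have hquot : ∀ l : ℕ, ((r + (c + 1) + l + 1).factorial : ℚ) / (r + l + 2).factorial =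
        (ascPochhammer ℚ c).eval ((r : ℚ) + 3 + l * 1) := by
      intro l
      rw [div_eq_iff (by positivity), show r + (c + 1) + l + 1 = r + l + 2 + c by ring,
        ← factorial_mul_ascPochhammer ℚ (r + l + 2) c, mul_comm]
      congr 2
      push_cast
      ring
    simp only [hquot]
    rw [if_neg c.succ_ne_zero, sum_neg_one_pow_choose_mul_eval_eq_zero
      (by rw [ascPochhammer_natDegree]; exact c.lt_succ_self)]

theorem eval_relaxZCoeffPoly_neg {m r : ℕ} (c : ℕ) (hr : r ≤ m) :
    (relaxZCoeffPoly m c).eval (-(r : ℚ)) = if c = 0 then -1 else 0 := by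
  have hsum : (relaxZCoeffPoly m c).eval (-(r : ℚ)) = -((r + 2) * (-1) ^ c / c.factorial) *
      ∑ l ∈ Finset.range (c + 1), (-1 : ℚ) ^ l * (c.choose l : ℚ) *
        (((r + c + l + 1).factorial : ℚ) / (r + l + 2).factorial) := by
    rw [eval_relaxZCoeffPoly, Finset.mul_sum]
    refine Finset.sum_congr rfl fun l hl => ?_
    have hlc := Finset.mem_range_succ_iff.1 hl
    have hcast : -(r : ℚ) - (2 * l + 2) = -(((r + 2 * l + 1 : ℕ) : ℚ) + 1) := by push_cast; ring
    rw [eval_relaxGammaPoly_neg hr, hcast, eval_binomPoly_neg,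
      show r + 2 * l + 1 + (c - l) = r + c + l + 1 by omega, Nat.cast_choose ℚ (by omega),
      show r + c + l + 1 - (c - l) = r + 2 * l + 1 by omega, Nat.cast_choose ℚ hlc,
      show (-1 : ℚ) ^ (c - l) = (-1) ^ c * (-1) ^ l by
        rw [← pow_add]; exact neg_one_pow_congr (by grind)]
    field_simp
  rw [hsum, sum_neg_one_pow_choose_mul_factorial_div]
  split_ifs with hc
  · subst hc
    simp only [pow_zero, Nat.factorial_zero, Nat.cast_one]
    field_simp
  · rw [mul_zero]

theorem sum_neg_one_pow_choose_tail {k : ℕ} (m : ℕ) (hk : 1 ≤ k) :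
    ∑ i ∈ Finset.range (m + 1), (-1 : ℤ) ^ (k + i) * ((k + m).choose (k + i) : ℤ) =
      (-1) ^ k * ((k + m - 1).choose (k - 1) : ℤ) := by
  obtain ⟨k, rfl⟩ := Nat.exists_eq_add_of_le' hk
  have htotal := Int.alternating_sum_range_choose_of_ne (n := k + 1 + m) (by omega)
  have hhead := Int.alternating_sum_range_choose_eq_choose (n := k + m) (m := k)
  rw [show k + m + 1 = k + 1 + m by ring] at hhead
  rw [show k + 1 + m + 1 = (k + 1) + (m + 1) by ring, Finset.sum_range_add, hhead] at htotal
  rw [show k + 1 + m - 1 = k + m by omega, Nat.add_sub_cancel, pow_succ]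
  linarith

theorem sum_neg_one_pow_choose_mul_coeff_relaxZClosed {m k b : ℕ} (hk : 2 ≤ k) (hb : 2 * b ≤ k) :
    ∑ i ∈ Finset.range k,
        (-1 : ℚ) ^ i * ((k + m).choose i : ℚ) * (relaxZClosed m (k - i)).coeff b =
      if b = 1 then (-1) ^ k * ((k + m - 1).choose (k - 1) : ℚ) else 0 := by
  rcases b with _ | c
  · simp [coeff_zero_relaxZClosed]
  have hzero := sum_neg_one_pow_choose_mul_eval_eq_zero (n := k + m) (f := relaxZCoeffPoly m c)
    ((natDegree_relaxZCoeffPoly_le m c).trans_lt (by omega)) k (-1)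
  simp only [mul_neg_one, ← sub_eq_add_neg] at hzero
  rw [add_assoc, Finset.sum_range_add] at hzero
  have hhead : ∀ i ∈ Finset.range k, (-1 : ℚ) ^ i * ((k + m).choose i : ℚ) *
      (relaxZCoeffPoly m c).eval ((k : ℚ) - i) =
      (-1 : ℚ) ^ i * ((k + m).choose i : ℚ) * (relaxZClosed m (k - i)).coeff (c + 1) := by
    intro i hi
    have hik := Finset.mem_range.1 hi
    rw [← Nat.cast_sub hik.le, eval_relaxZCoeffPoly_natCast (by omega)]
  have htail : ∀ i ∈ Finset.range (m + 1), (-1 : ℚ) ^ (k + i) * ((k + m).choose (k + i) : ℚ) *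
      (relaxZCoeffPoly m c).eval ((k : ℚ) - (k + i : ℕ)) =
      (-1 : ℚ) ^ (k + i) * ((k + m).choose (k + i) : ℚ) * if c = 0 then -1 else 0 := by
    intro i hi
    rw [Nat.cast_add k i, sub_add_cancel_left,
      eval_relaxZCoeffPoly_neg c (Finset.mem_range_succ_iff.1 hi)]
  have hchoose := congrArg (Int.cast (R := ℚ)) (sum_neg_one_pow_choose_tail m (by omega : 1 ≤ k))
  push_cast at hchoose
  rw [Finset.sum_congr rfl hhead, Finset.sum_congr rfl htail, ← Finset.sum_mul, hchoose] at hzero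
  rw [eq_neg_of_add_eq_zero_left hzero]
  simp only [Nat.add_eq_right]
  split_ifs <;> ring

/-! ### Palindromic polynomials and their `γ`-coefficients -/

section Reflect

variable {R : Type*}

theorem reflect_sum [Semiring R] {ι : Type*} (N : ℕ) (s : Finset ι) (f : ι → R[X]) :
    reflect N (∑ i ∈ s, f i) = ∑ i ∈ s, reflect N (f i) := by
  ext
  simp only [coeff_reflect, finsetSum_coeff]

theorem reflect_eq_self_of_coeff_sub [Semiring R] {f : R[X]} {k : ℕ}
    (hf : ∀ i, 2 * i < k → f.coeff (k - i) = f.coeff i) : f.reflect k = f := by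
  ext i
  rw [coeff_reflect]
  rcases le_or_gt i k with hik | hki
  · rw [revAt_le hik]
    rcases lt_trichotomy (2 * i) k with h | h | h
    · exact hf i h
    · rw [show k - i = i by omega]
    · conv_rhs => rw [← Nat.sub_sub_self hik]
      exact (hf (k - i) (by omega)).symm
  · rw [revAt_eq_self_of_lt hki]

theorem coeff_sub_of_reflect_eq_self [Semiring R] {f : R[X]} {k i : ℕ} (hf : f.reflect k = f)
    (hik : i ≤ k) : f.coeff (k - i) = f.coeff i := by
  conv_rhs => rw [← hf, coeff_reflect, revAt_le hik]

theorem ext_of_reflect_eq_self [Semiring R] {f g : R[X]} {k : ℕ} (hf : f.reflect k = f)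
    (hg : g.reflect k = g) (h : ∀ i, k ≤ 2 * i → f.coeff i = g.coeff i) : f = g := by
  ext i
  rcases le_or_gt k (2 * i) with hi | hi
  · exact h i hi
  · rw [← coeff_sub_of_reflect_eq_self hf (by omega), ← coeff_sub_of_reflect_eq_self hg (by omega)]
    exact h (k - i) (by omega)

theorem reflect_X_pow_mul_one_add_X_pow [Semiring R] {i k : ℕ} (hik : 2 * i ≤ k) :
    reflect k ((X : R[X]) ^ i * (1 + X) ^ (k - 2 * i)) = X ^ i * (1 + X) ^ (k - 2 * i) := by
  refine reflect_eq_self_of_coeff_sub fun j hj => ?_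
  rw [coeff_X_pow_mul', coeff_X_pow_mul', coeff_one_add_X_pow, coeff_one_add_X_pow,
    if_pos (by omega)]
  split_ifs with hij
  · rw [Nat.choose_symm_of_eq_add (show k - 2 * i = (k - j - i) + (j - i) by omega)]
  · rw [Nat.choose_eq_zero_of_lt (by omega), Nat.cast_zero]

theorem reflect_one_add_X_mul [Semiring R] {f : R[X]} {k : ℕ} (hf : f.reflect k = f)
    (hdeg : f.natDegree ≤ k) : reflect (k + 1) ((1 + X) * f) = (1 + X) * f := by
  have hone : reflect 1 (1 + X : R[X]) = 1 + X := by
    simpa using reflect_X_pow_mul_one_add_X_pow (R := R) (i := 0) (k := 1) (by omega)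
  rw [add_comm k, reflect_mul _ _ (by compute_degree) hdeg, hone, hf]

end Reflect

theorem gammaCoeff_add (f g : ℤ[X]) (d m : ℕ) :
    gammaCoeff (f + g) d m = gammaCoeff f d m + gammaCoeff g d m := by
  induction m using Nat.strong_induction_on with
  | _ m ih =>
    rw [gammaCoeff, gammaCoeff, gammaCoeff, coeff_add,
      Finset.sum_congr rfl fun i _ => by rw [ih i i.2, add_mul], Finset.sum_add_distrib]
    ring

theorem cast_gammaCoeff {R : Type*} [CommRing R] {f : ℤ[X]} {d N : ℕ} {c : ℕ → R}
    (hf : f.map (Int.castRingHom R) =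
      ∑ i ∈ Finset.range N, C (c i) * (X ^ i * (1 + X) ^ (d - 2 * i))) (m : ℕ) :
    (gammaCoeff f d m : R) = if m < N then c m else 0 := by
  induction m using Nat.strong_induction_on with
  | _ m ih =>
    have hcoeff : (f.coeff m : R) = ∑ i ∈ Finset.range (m + 1),
        (if i < N then c i else 0) * ((d - 2 * i).choose (m - i) : R) := by
      have h := congrArg (coeff · m) hf
      simp only [coeff_map, eq_intCast, finsetSum_coeff, coeff_C_mul, coeff_X_pow_mul',
        coeff_one_add_X_pow, mul_ite, mul_zero] at h
      simp only [h, ite_mul, zero_mul, ← Finset.sum_filter]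
      refine Finset.sum_congr (Finset.ext fun i => ?_) fun _ _ => rfl
      simp only [Finset.mem_filter, Finset.mem_range]
      omega
    rw [gammaCoeff_eq f d m, Finset.sum_range_succ, Finset.sum_range_succ] at hcoeff
    push_cast at hcoeff
    rw [Finset.sum_congr rfl fun i hi => by rw [ih i (Finset.mem_range.1 hi)]] at hcoeff
    simpa using hcoeff

/-- The truncation to degree at most `d / 2` of the expansion of a polynomial in terms of the
`t ^ i (1 + t) ^ (d - 2 i)`. It is the `γ`-polynomial for palindromic polynomials of degree `d`,
but unlike that it is additive. -/
noncomputable def gammaOfDegree (d : ℕ) : ℤ[X] →+ ℤ[X] :=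
  AddMonoidHom.mk' (fun f => ∑ i ∈ Finset.range (d / 2 + 1), monomial i (gammaCoeff f d i))
    fun f g => by simp only [gammaCoeff_add, map_add, Finset.sum_add_distrib]

theorem gammaPoly_eq_gammaOfDegree (f : ℤ[X]) : gammaPoly f = gammaOfDegree f.natDegree f := rfl

theorem coeff_gammaOfDegree (d : ℕ) (f : ℤ[X]) (i : ℕ) :
    (gammaOfDegree d f).coeff i = if i ≤ d / 2 then gammaCoeff f d i else 0 := by
  simp [gammaOfDegree, coeff_monomial]

theorem gammaOfDegree_one_add_X_mul {f : ℤ[X]} {d : ℕ} (hf : f.reflect d = f)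
    (hd : f.natDegree = d) : gammaOfDegree (d + 1) ((1 + X) * f) = gammaOfDegree d f := by
  subst hd
  have hexp : ((1 + X) * f).map (Int.castRingHom ℤ) =
      ∑ i ∈ Finset.range (f.natDegree / 2 + 1),
        C ((gammaPoly f).coeff i) * (X ^ i * (1 + X) ^ (f.natDegree + 1 - 2 * i)) := by
    conv_lhs => rw [gammaPoly_expansion f hf]
    rw [Int.castRingHom_int, Polynomial.map_id, Finset.mul_sum]
    refine Finset.sum_congr rfl fun i hi => ?_
    have hid := Finset.mem_range.1 hi
    rw [show f.natDegree + 1 - 2 * i = f.natDegree - 2 * i + 1 by omega, pow_succ]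
    ring
  ext i
  have hcoeff := cast_gammaCoeff hexp i
  rw [Int.cast_id] at hcoeff
  rw [← gammaPoly_eq_gammaOfDegree, coeff_gammaOfDegree, hcoeff, gammaPoly_coeff]
  split_ifs <;> first | rfl | omega

/-! ### Ranks and flats of restrictions and contractions -/

theorem mu_orderEmbedding {P Q 𝕜 : Type*} [PartialOrder P] [PartialOrder Q] [LocallyFiniteOrder P]
    [LocallyFiniteOrder Q] [DecidableEq P] [DecidableEq Q] [AddCommGroup 𝕜] [One 𝕜] (f : P ↪o Q)
    (hf : ∀ p q, q ≤ f p → ∃ p', f p' = q) (a b : P) :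
    IncidenceAlgebra.mu 𝕜 (f a) (f b) = IncidenceAlgebra.mu 𝕜 a b := by
  induction hn : (Finset.Ico a b).card using Nat.strong_induction_on generalizing b with
  | _ n ih =>
  rw [IncidenceAlgebra.mu_apply, IncidenceAlgebra.mu_apply (a := a)]
  by_cases hab : a = b
  · rw [if_pos hab, if_pos (congrArg f hab)]
  rw [if_neg hab, if_neg (fun h => hab (f.injective h))]
  have himage : Finset.Ico (f a) (f b) = (Finset.Ico a b).map f.toEmbedding := by
    ext q
    simp only [Finset.mem_Ico, Finset.mem_map, RelEmbedding.coe_toEmbedding]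
    constructor
    · rintro ⟨haq, hqb⟩
      obtain ⟨p, rfl⟩ := hf b q hqb.le
      exact ⟨p, ⟨f.le_iff_le.1 haq, f.lt_iff_lt.1 hqb⟩, rfl⟩
    · rintro ⟨p, ⟨hap, hpb⟩, rfl⟩
      exact ⟨f.le_iff_le.2 hap, f.lt_iff_lt.2 hpb⟩
  rw [himage, Finset.sum_map]
  refine congrArg Neg.neg (Finset.sum_congr rfl fun x hx => ih _ ?_ x rfl)
  have hxb := (Finset.mem_Ico.1 hx).2
  rw [← hn]
  refine Finset.card_lt_card ⟨Finset.Ico_subset_Ico_right hxb.le, fun h => ?_⟩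
  exact (Finset.mem_Ico.1 (h hx)).2.ne rfl

section Rank

variable {α : Type*} {M : Matroid α} {F G X Y K : Set α}

theorem cast_natRk (M : Matroid α) [M.RankFinite] (X : Set α) : (M.natRk X : ℕ∞) = M.eRk X :=
  ENat.natCast_toNat
    (ne_top_of_le_ne_top ((M.eRank_ne_top_iff).2 inferInstance) (M.eRk_le_eRank X))

theorem cast_natRank (M : Matroid α) [M.RankFinite] : (M.natRank : ℕ∞) = M.eRank := by
  rw [Matroid.natRank, cast_natRk, Matroid.eRk_ground]

theorem natRk_mono (M : Matroid α) [M.RankFinite] (h : X ⊆ Y) : M.natRk X ≤ M.natRk Y := by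
  exact_mod_cast (cast_natRk M X).trans_le ((M.eRk_mono h).trans (cast_natRk M Y).ge)

theorem natRk_lt_of_isFlat [M.RankFinite] (hF : M.IsFlat F) (h : F ⊂ X) (hX : X ⊆ M.E) :
    M.natRk F < M.natRk X := by
  obtain ⟨e, heX, heF⟩ := Set.exists_of_ssubset h
  have hinsert := M.eRk_insert_eq_add_one (e := e) (X := F) ⟨hX heX, by rwa [hF.closure]⟩
  rw [← cast_natRk, ← cast_natRk] at hinsert
  have hsucc : M.natRk (insert e F) = M.natRk F + 1 := by exact_mod_cast hinsert
  have hle := natRk_mono M (Set.insert_subset heX h.subset)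
  omega

theorem eRk_contract_add (M : Matroid α) (K X : Set α) :
    (M ／ K).eRk X + M.eRk K = M.eRk (X ∪ K) := by
  obtain ⟨I, hI⟩ := M.exists_isBasis' K
  obtain ⟨J, hJ, hIJ⟩ := hI.indep.subset_isBasis'_of_subset
    (hI.subset.trans (Set.subset_union_right (s := X)))
  have hJK : J ∩ K = I := (hI.eq_of_subset_indep (hJ.indep.inter_right K)
    (Set.subset_inter hIJ hI.subset) Set.inter_subset_right).symm
  have hB := hJ.contract_isBasis' hI (hJ.indep.subset (Set.union_subset Set.sdiff_subset hIJ))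
  have hrk : (M ／ K).eRk X = (J \ K).encard := by
    rw [hB.encard_eq_eRk, ← Matroid.eRk_inter_ground, ← Matroid.eRk_inter_ground _ ((X ∪ K) \ K),
      Matroid.contract_ground]
    congr 1
    tauto_set
  rw [hrk, ← hI.encard_eq_eRk, ← hJ.encard_eq_eRk, ← hJK, Set.encard_sdiff_add_encard_inter]

theorem natRk_contract_add (M : Matroid α) [M.Finite] (K X : Set α) :
    (M ／ K).natRk X + M.natRk K = M.natRk (X ∪ K) := by
  have h := eRk_contract_add M K X
  rw [← cast_natRk, ← cast_natRk, ← cast_natRk] at h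
  exact_mod_cast h

theorem natRank_contract_add (M : Matroid α) [M.Finite] (hK : K ⊆ M.E) :
    (M ／ K).natRank + M.natRk K = M.natRank := by
  rw [Matroid.natRank, natRk_contract_add, Matroid.contract_ground, Set.sdiff_union_of_subset hK,
    Matroid.natRank]

theorem isFlat_contract_iff (hF : F ⊆ M.E) :
    (M ／ F).IsFlat G ↔ M.IsFlat (G ∪ F) ∧ Disjoint G F := by
  rw [Matroid.isFlat_iff_closure_eq, Matroid.isFlat_iff_closure_eq, Matroid.contract_closure_eq]
  constructor
  · intro h
    refine ⟨?_, h ▸ Set.disjoint_sdiff_left⟩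
    conv_rhs => rw [← h]
    rw [Set.sdiff_union_of_subset]
    exact (M.subset_closure F).trans (M.closure_subset_closure Set.subset_union_right)
  · rintro ⟨hclosure, hdisj⟩
    rw [hclosure, Set.union_sdiff_right, hdisj.sdiff_eq_left]

theorem isFlat_restrict_iff (hF : M.IsFlat F) : (M ↾ F).IsFlat G ↔ M.IsFlat G ∧ G ⊆ F := by
  constructor
  · intro h
    have hGF : G ⊆ F := h.subset_ground
    have hclosure := h.closure
    rw [Matroid.restrict_closure_eq _ hGF hF.subset_ground, Set.inter_eq_left.2] at hclosure
    · exact ⟨Matroid.isFlat_iff_closure_eq.2 hclosure, hGF⟩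
    · exact hF.closure ▸ M.closure_subset_closure hGF
  · rintro ⟨hG, hGF⟩
    rw [Matroid.isFlat_iff_closure_eq, Matroid.restrict_closure_eq _ hGF hF.subset_ground,
      hG.closure, Set.inter_eq_left.2 hGF]

theorem botFlat_val (M : Matroid α) [M.Loopless] : M.botFlat.1 = ∅ := M.loops_eq_empty

theorem botFlat_le (M : Matroid α) (F : M.Flats) : M.botFlat ≤ F := F.2.loops_subset

theorem natRk_botFlat (M : Matroid α) : M.natRk M.botFlat.1 = 0 := by
  simp [Matroid.natRk, Matroid.botFlat, Matroid.eRk_closure_eq]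

end Rank

/-! ### Kazhdan–Lusztig polynomials and `Z`-polynomials -/

section KLPoly

variable {α : Type*}

theorem klPoly_congr {M N : Matroid α} [M.Finite] [N.Finite] (h : M = N) :
    M.klPoly = N.klPoly := by
  subst h; rfl

open Classical in
theorem sum_flats_contract {A : Type*} [AddCommMonoid A] (M : Matroid α) [M.Finite] (F : M.Flats)
    (f : Set α → A) :
    ∑ G : (M ／ F.1).Flats, f (G.1 ∪ F.1) = ∑ H : M.Flats with F ≤ H, f H.1 := by
  refine Finset.sum_bij'
    (fun G _ => ⟨G.1 ∪ F.1, ((isFlat_contract_iff F.2.subset_ground).1 G.2).1⟩)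
    (fun H hH => ⟨H.1 \ F.1, (isFlat_contract_iff F.2.subset_ground).2
      ⟨?_, Set.disjoint_sdiff_left⟩⟩) ?_ ?_ ?_ ?_ ?_
  · rw [Set.sdiff_union_of_subset (Finset.mem_filter.1 hH).2]
    exact H.2
  · exact fun G _ => Finset.mem_filter.2 ⟨Finset.mem_univ _, Set.subset_union_right⟩
  · exact fun _ _ => Finset.mem_univ _
  · intro G _
    have hdisj := ((isFlat_contract_iff F.2.subset_ground).1 G.2).2
    exact Subtype.ext (by simp only [Set.union_sdiff_right, hdisj.sdiff_eq_left])
  · exact fun H hH => Subtype.ext (Set.sdiff_union_of_subset (Finset.mem_filter.1 hH).2)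
  · exact fun _ _ => rfl

open Classical in
theorem zPoly_contract (M : Matroid α) [M.Finite] (F : M.Flats) :
    (M ／ F.1).zPoly =
      ∑ H : M.Flats with F ≤ H, X ^ (M.natRk H.1 - M.natRk F.1) * (M ／ H.1).klPoly := by
  rw [← sum_flats_contract M F
    (fun H => X ^ (M.natRk H - M.natRk F.1) * (M ／ H).klPoly), Matroid.zPoly]
  refine Finset.sum_congr rfl fun G _ => ?_
  rw [← natRk_contract_add, Nat.add_sub_cancel]
  exact congrArg _ (klPoly_congr (by rw [Matroid.contract_contract, Set.union_comm]))

/-- The embedding of the lattice of flats of the localization of `M` at `F` as the interval of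
flats of `M` below `F`. -/
def flatsLocalization (M : Matroid α) (F : M.Flats) : (M.localization F).Flats ↪o M.Flats where
  toFun G := ⟨G.1, ((isFlat_restrict_iff F.2).1 G.2).1⟩
  inj' _ _ h := Subtype.ext (congrArg (fun K => K.1) h)
  map_rel_iff' := Iff.rfl

theorem exists_flatsLocalization_eq {M : Matroid α} {F H : M.Flats} (h : H ≤ F) :
    ∃ G, flatsLocalization M F G = H :=
  ⟨⟨H.1, (isFlat_restrict_iff F.2).2 ⟨H.2, h⟩⟩, rfl⟩

theorem flatsLocalization_le {M : Matroid α} {F : M.Flats} (G : (M.localization F).Flats) :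
    flatsLocalization M F G ≤ F := ((isFlat_restrict_iff F.2).1 G.2).2

theorem flatsLocalization_botFlat (M : Matroid α) (F : M.Flats) :
    flatsLocalization M F (M.localization F).botFlat = M.botFlat := by
  refine Subtype.ext ?_
  change (M ↾ F.1).closure ∅ = M.closure ∅
  rw [Matroid.restrict_closure_eq _ (Set.empty_subset _) F.2.subset_ground, Set.inter_eq_left]
  exact F.2.loops_subset

theorem natRk_localization (M : Matroid α) {F : M.Flats} {X : Set α} (hX : X ⊆ F.1) :
    (M.localization F).natRk X = M.natRk X := by
  rw [Matroid.natRk, Matroid.natRk, Matroid.localization, Matroid.restrict_eRk_eq _ hX]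

open Classical in
theorem charPoly_localization (M : Matroid α) [M.Finite] (F : M.Flats) :
    (M.localization F).charPoly = ∑ G : M.Flats with G ≤ F,
      C (IncidenceAlgebra.mu ℤ M.botFlat G) * X ^ (M.natRk F.1 - M.natRk G.1) := by
  refine Finset.sum_bij (fun G _ => flatsLocalization M F G)
    (fun G _ => Finset.mem_filter.2 ⟨Finset.mem_univ _, flatsLocalization_le G⟩)
    (fun _ _ _ _ h => (flatsLocalization M F).injective h) ?_ ?_
  · intro H hH
    obtain ⟨G, hG⟩ := exists_flatsLocalization_eq (Finset.mem_filter.1 hH).2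
    exact ⟨G, Finset.mem_univ _, hG⟩
  · intro G _
    rw [← flatsLocalization_botFlat M F, mu_orderEmbedding _
      (fun p q hq => exists_flatsLocalization_eq (hq.trans (flatsLocalization_le p))),
      ← natRk_localization M subset_rfl, ← natRk_localization M (flatsLocalization_le G)]
    rfl

theorem klPoly_of_ground_eq_empty {M : Matroid α} [M.Finite] (h : M.E = ∅) : M.klPoly = 1 := by
  rw [Matroid.klPoly, if_pos h]

theorem klPoly_of_not_loopless {M : Matroid α} [M.Finite] (h : ¬ M.Loopless) : M.klPoly = 0 := by
  have hE : M.E ≠ ∅ := fun hE => h ((Matroid.loopless_iff M).2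
    (Set.subset_empty_iff.1 (hE ▸ M.loops_subset_ground)))
  rw [Matroid.klPoly, if_neg hE, if_neg h]

theorem coeff_klPoly_eq_zero (M : Matroid α) [M.Finite] {i : ℕ} (hi : i ≠ 0)
    (h : M.natRank ≤ 2 * i) : M.klPoly.coeff i = 0 := by
  rw [Matroid.klPoly]
  split_ifs
  · rw [coeff_one, if_neg hi]
  · rw [finsetSum_coeff]
    refine Finset.sum_eq_zero fun j hj => ?_
    have hjk := (Finset.mem_filter.1 hj).2
    rw [coeff_monomial, if_neg (by omega)]
  · rw [coeff_zero]

theorem coeff_zPoly (M : Matroid α) [M.Finite] (j : ℕ) : M.zPoly.coeff j =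
    ∑ F : M.Flats, if M.natRk F.1 ≤ j then (M ／ F.1).klPoly.coeff (j - M.natRk F.1) else 0 := by
  simp only [Matroid.zPoly, finsetSum_coeff, coeff_X_pow_mul']

theorem coeff_zPoly_eq_zero (M : Matroid α) [M.Finite] {j : ℕ} (hj : M.natRank < j) :
    M.zPoly.coeff j = 0 := by
  rw [coeff_zPoly]
  refine Finset.sum_eq_zero fun F _ => ?_
  have hrank := natRank_contract_add M F.2.subset_ground
  rw [if_pos (by omega)]
  exact coeff_klPoly_eq_zero _ (by omega) (by omega)

theorem coeff_zPoly_natRank (M : Matroid α) [M.Finite] : M.zPoly.coeff M.natRank = 1 := by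
  rw [coeff_zPoly, Fintype.sum_eq_single (⟨M.E, M.ground_isFlat⟩ : M.Flats)]
  · rw [← Matroid.natRank, if_pos le_rfl, klPoly_of_ground_eq_empty (by simp), Nat.sub_self,
      coeff_one_zero]
  · intro F hF
    have hlt : M.natRk F.1 < M.natRank := natRk_lt_of_isFlat F.2
      (F.2.subset_ground.ssubset_of_ne fun h => hF (Subtype.ext h)) subset_rfl
    have hrank := natRank_contract_add M F.2.subset_ground
    rw [if_pos hlt.le]
    exact coeff_klPoly_eq_zero _ (by omega) (by omega)

theorem natDegree_zPoly (M : Matroid α) [M.Finite] : M.zPoly.natDegree = M.natRank :=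
  (natDegree_le_iff_coeff_eq_zero.2 fun _ => coeff_zPoly_eq_zero M).antisymm
    (le_natDegree_of_ne_zero (by rw [coeff_zPoly_natRank]; exact one_ne_zero))

theorem zPoly_contract_botFlat (M : Matroid α) [M.Finite] :
    (M ／ M.botFlat.1).zPoly = M.zPoly := by
  classical
  rw [zPoly_contract, Finset.filter_true_of_mem fun F _ => botFlat_le M F, natRk_botFlat]
  rfl

end KLPoly

section Palindromic

variable {α : Type*} (M : Matroid α) [M.Finite]

open Classical in
theorem sum_charPoly_localization_mul_klPoly_contract :
    ∑ F : M.Flats, (M.localization F).charPoly * (M ／ F.1).klPoly =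
      ∑ G : M.Flats, C (IncidenceAlgebra.mu ℤ M.botFlat G) * (M ／ G.1).zPoly := by
  simp only [charPoly_localization, zPoly_contract, Finset.sum_mul, Finset.mul_sum,
    Finset.sum_filter]
  rw [Finset.sum_comm]
  refine Finset.sum_congr rfl fun G _ => Finset.sum_congr rfl fun F _ => ?_
  split_ifs
  · rw [mul_assoc]
  · rw [zero_mul, mul_zero]

open Classical in
theorem sum_mu_mul_X_pow_mul_zPoly_contract :
    ∑ G : M.Flats, C (IncidenceAlgebra.mu ℤ M.botFlat G) * (X ^ M.natRk G.1 * (M ／ G.1).zPoly) =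
      (M ／ M.botFlat.1).klPoly := by
  have hmu (F : M.Flats) : ∑ G : M.Flats with G ≤ F, IncidenceAlgebra.mu ℤ M.botFlat G =
      if M.botFlat = F then 1 else 0 := by
    rw [← IncidenceAlgebra.sum_Icc_mu_right]
    refine Finset.sum_congr (Finset.ext fun G => ?_) fun _ _ => by congr
    simp only [Finset.mem_filter, Finset.mem_univ, true_and, Finset.mem_Icc, botFlat_le M G]
  calc ∑ G : M.Flats, C (IncidenceAlgebra.mu ℤ M.botFlat G) *
        (X ^ M.natRk G.1 * (M ／ G.1).zPoly)
      = ∑ F : M.Flats, C (∑ G : M.Flats with G ≤ F, IncidenceAlgebra.mu ℤ M.botFlat G) *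
          (X ^ M.natRk F.1 * (M ／ F.1).klPoly) := by
        simp only [zPoly_contract, Finset.mul_sum, map_sum, Finset.sum_mul, Finset.sum_filter]
        rw [Finset.sum_comm]
        refine Finset.sum_congr rfl fun F _ => Finset.sum_congr rfl fun G _ => ?_
        split_ifs with hGF
        · rw [← mul_assoc (X ^ _), ← pow_add, Nat.add_sub_cancel' (natRk_mono M hGF)]
        · simp only [mul_zero, map_zero, zero_mul]
    _ = (M ／ M.botFlat.1).klPoly := by
        simp only [hmu, apply_ite (C : ℤ → ℤ[X]), map_one, map_zero, ite_mul, one_mul, zero_mul,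
          Finset.sum_ite_eq, Finset.mem_univ, if_true, natRk_botFlat, pow_zero]

theorem ground_ne_empty_of_natRank_pos {M : Matroid α} (h : 0 < M.natRank) : M.E ≠ ∅ := by
  intro hE
  rw [Matroid.natRank, Matroid.natRk, hE, Matroid.eRk_empty] at h
  exact h.ne rfl

theorem charPoly_localization_botFlat : (M.localization M.botFlat).charPoly = 1 := by
  classical
  have hbot : Finset.univ.filter (· ≤ M.botFlat) = {M.botFlat} := by
    ext G
    simp [le_antisymm_iff, botFlat_le M G]
  rw [charPoly_localization, hbot, Finset.sum_singleton,
    IncidenceAlgebra.mu_self, map_one, Nat.sub_self, pow_zero, mul_one]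

theorem klPoly_contract_botFlat [M.Loopless] : (M ／ M.botFlat.1).klPoly = M.klPoly :=
  klPoly_congr (by rw [botFlat_val, Matroid.contract_empty])

theorem coeff_sum_charPoly_mul_klPoly [M.Loopless] {i : ℕ} (hi : 2 * i < M.natRank) :
    (∑ F : M.Flats, (M.localization F).charPoly * (M ／ F.1).klPoly).coeff i = 0 := by
  classical
  have hklPoly : M.klPoly.coeff i = -(∑ F ∈ Finset.univ.erase M.botFlat,
      (M.localization F).charPoly * (M ／ F.1).klPoly).coeff i := by
    rw [Matroid.klPoly, if_neg (ground_ne_empty_of_natRank_pos (by omega)), if_pos ‹M.Loopless›,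
      finsetSum_coeff]
    have hmem : i ∈ (Finset.range M.natRank).filter (2 * · < M.natRank) :=
      Finset.mem_filter.2 ⟨Finset.mem_range.2 (by omega), hi⟩
    simp only [coeff_monomial]
    rw [Finset.sum_ite_eq', if_pos hmem,
      ← Finset.sum_subtype (Finset.univ.erase M.botFlat) (p := fun F : M.Flats => F.1 ≠ ∅)
        (f := fun F : M.Flats => (M.localization F).charPoly * (M ／ F.1).klPoly)]
    intro F
    rw [Finset.mem_erase, ← botFlat_val M]
    simp [Subtype.ext_iff]
  rw [← Finset.add_sum_erase _ _ (Finset.mem_univ M.botFlat), charPoly_localization_botFlat,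
    one_mul, klPoly_contract_botFlat, coeff_add, hklPoly, neg_add_cancel]

theorem reflect_add_eq_X_pow_mul {R : Type*} [Semiring R] {f : R[X]} (m : ℕ) {n : ℕ}
    (hf : f.natDegree ≤ n) : reflect (m + n) f = X ^ m * reflect n f := by
  simpa only [one_mul, reflect_one] using reflect_mul (1 : R[X]) f (F := m) (by simp) hf

theorem botFlat_val_ne_empty {M : Matroid α} (hM : ¬ M.Loopless) : M.botFlat.1 ≠ ∅ := fun h =>
  hM ((Matroid.loopless_iff_forall_not_isLoop).2 fun e _ (he : e ∈ M.closure ∅) =>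
    Set.notMem_empty e (h ▸ he))

/- The sum `∑ F, χ_{M ↾ F} P_{M ／ F}` equals `Z_M + S`, where `S` is the part of
`∑ G, μ(⊥, G) Z_{M ／ G}` with `G ≠ ⊥`. It has no coefficients in degrees below `k / 2`, while
by induction reversing `S` gives `P_M - Z_M`. -/
theorem reflect_zPoly (M : Matroid α) [M.Finite] : M.zPoly.reflect M.natRank = M.zPoly := by
  classical
  induction hn : M.E.ncard using Nat.strong_induction_on generalizing M with
  | _ n ih =>
  subst hn
  by_cases hloopless : M.Loopless
  · set S := ∑ G ∈ Finset.univ.erase M.botFlat,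
      C (IncidenceAlgebra.mu ℤ M.botFlat G) * (M ／ G.1).zPoly with hS
    have hsum : ∑ F : M.Flats, (M.localization F).charPoly * (M ／ F.1).klPoly = M.zPoly + S := by
      rw [sum_charPoly_localization_mul_klPoly_contract,
        ← Finset.add_sum_erase _ _ (Finset.mem_univ M.botFlat), IncidenceAlgebra.mu_self, map_one,
        one_mul, zPoly_contract_botFlat]
    have hreflect : S.reflect M.natRank = M.klPoly - M.zPoly := by
      rw [← klPoly_contract_botFlat, ← sum_mu_mul_X_pow_mul_zPoly_contract,
        ← Finset.add_sum_erase _ _ (Finset.mem_univ M.botFlat), IncidenceAlgebra.mu_self, map_one,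
        one_mul, zPoly_contract_botFlat, natRk_botFlat, pow_zero, one_mul, add_sub_cancel_left, hS,
        reflect_sum]
      refine Finset.sum_congr rfl fun G hG => ?_
      have hne : G.1 ≠ ∅ := fun h =>
        (Finset.mem_erase.1 hG).1 (Subtype.ext (h.trans (botFlat_val M).symm))
      rw [reflect_C_mul, ← natRank_contract_add M G.2.subset_ground, add_comm (Matroid.natRank _),
        reflect_add_eq_X_pow_mul _ (natDegree_zPoly _).le, ih _ (M.ncard_contract_lt G hne) _ rfl]
    refine reflect_eq_self_of_coeff_sub fun i hi => ?_
    have hlow := coeff_sum_charPoly_mul_klPoly M hi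
    have hhigh := congrArg (coeff · (M.natRank - i)) hreflect
    have hvanish : M.klPoly.coeff (M.natRank - i) = 0 :=
      coeff_klPoly_eq_zero M (by omega) (by omega)
    simp only [coeff_reflect, revAt_le (Nat.sub_le _ i),
      Nat.sub_sub_self (by omega : i ≤ M.natRank), coeff_sub, hvanish] at hhigh
    rw [hsum, coeff_add] at hlow
    linarith
  · have h := ih _ (M.ncard_contract_lt _ (botFlat_val_ne_empty hloopless)) (M ／ M.botFlat.1) rfl
    have hrank := natRank_contract_add M M.botFlat.2.subset_ground
    rw [natRk_botFlat, add_zero] at hrank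
    rwa [zPoly_contract_botFlat, hrank] at h

end Palindromic

section LowRank

variable {α : Type*} (M : Matroid α) [M.Finite] [M.Loopless]

theorem coeff_zero_klPoly : M.klPoly.coeff 0 = 1 := by
  have hzPoly : M.zPoly.coeff 0 = M.klPoly.coeff 0 := by
    rw [coeff_zPoly, Fintype.sum_eq_single M.botFlat, natRk_botFlat, if_pos le_rfl,
      klPoly_contract_botFlat]
    intro F hF
    have hlt := natRk_lt_of_isFlat M.botFlat.2 (X := F.1)
      ((botFlat_le M F).lt_of_ne hF.symm) F.2.subset_ground
    rw [if_neg (by omega)]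
  rw [← hzPoly, ← coeff_sub_of_reflect_eq_self (reflect_zPoly M) (Nat.zero_le _), Nat.sub_zero,
    coeff_zPoly_natRank]

theorem klPoly_eq_one (h : M.natRank ≤ 2) : M.klPoly = 1 := by
  ext i
  rcases eq_or_ne i 0 with rfl | hi
  · rw [coeff_zero_klPoly, coeff_one_zero]
  · rw [coeff_klPoly_eq_zero M hi (by omega), coeff_one, if_neg hi]

end LowRank

/-! ### Flats of paving matroids -/

section Paving

variable {α : Type*} {M : Matroid α} {X F : Set α}

theorem natRk_eq_ncard_of_indep (h : M.Indep X) : M.natRk X = X.ncard := by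
  rw [Matroid.natRk, h.eRk_eq_encard, Set.ncard]

theorem natRk_le_ncard (M : Matroid α) [M.Finite] (hX : X ⊆ M.E) : M.natRk X ≤ X.ncard := by
  have h := M.eRk_le_encard X
  rw [← cast_natRk, ← (M.ground_finite.subset hX).cast_ncard_eq] at h
  exact_mod_cast h

theorem loopless_contract (hF : M.IsFlat F) : (M ／ F).Loopless := by
  rw [Matroid.loopless_iff, Matroid.contract_loops_eq, hF.closure, Set.sdiff_self]

variable [M.Finite]

theorem indep_of_isPaving (hM : M.IsPaving) (hX : X ⊆ M.E) (h : X.ncard < M.natRank) :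
    M.Indep X := by
  rw [Matroid.indep_iff_forall_subset_not_isCircuit hX]
  intro C hCX hC
  have hle := (hM C hC).trans (Set.encard_le_encard hCX)
  rw [← cast_natRank, ← (M.ground_finite.subset hX).cast_ncard_eq] at hle
  exact h.not_ge (by exact_mod_cast hle)

theorem isFlat_of_isPaving (hM : M.IsPaving) (hX : X ⊆ M.E) (h : X.ncard + 2 ≤ M.natRank) :
    M.IsFlat X := by
  rw [Matroid.isFlat_iff_closure_eq]
  refine subset_antisymm (fun e he => ?_) (M.subset_closure X)
  by_contra heX
  have hI := indep_of_isPaving hM (X := insert e X)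
    (Set.insert_subset (M.closure_subset_ground X he) hX)
    ((Set.ncard_insert_le e X).trans_lt (by omega))
  refine hI.notMem_closure_sdiff_of_mem (Set.mem_insert e X) ?_
  rwa [Set.insert_sdiff_self_of_notMem heX]

theorem indep_of_isPaving_of_isFlat (hM : M.IsPaving) (hF : M.IsFlat F)
    (h : M.natRk F + 2 ≤ M.natRank) : M.Indep F := by
  obtain ⟨I, hI⟩ := M.exists_isBasis F hF.subset_ground
  have hcard : M.natRk F = I.ncard := by rw [Matroid.natRk, ← hI.encard_eq_eRk, Set.ncard]
  have hIflat := isFlat_of_isPaving hM hI.indep.subset_ground (by omega)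
  rw [← hF.closure, ← hI.closure_eq_closure, hIflat.closure]
  exact hI.indep

theorem loopless_of_isPaving (hM : M.IsPaving) (hk : 2 ≤ M.natRank) : M.Loopless := by
  rw [Matroid.loopless_iff, Matroid.loops, ← Matroid.isFlat_iff_closure_eq]
  exact isFlat_of_isPaving hM (Set.empty_subset _) (by simpa using hk)

theorem isPaving_contract (hM : M.IsPaving) (hF : M.Indep F) : (M ／ F).IsPaving := by
  intro K hK
  obtain ⟨C, hC, -, hCK⟩ := hK.exists_subset_isCircuit_of_contract
  have hle := (hM C hC).trans ((Set.encard_le_encard hCK).trans (Set.encard_union_le K F))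
  have hrank := natRank_contract_add M hF.subset_ground
  rw [natRk_eq_ncard_of_indep hF] at hrank
  rw [← cast_natRank,
    ← (M.ground_finite.subset (hK.subset_ground.trans Set.sdiff_subset)).cast_ncard_eq] at hle ⊢
  rw [← (M.ground_finite.subset hF.subset_ground).cast_ncard_eq, ← hrank] at hle
  norm_cast at hle ⊢
  omega

/-- The hyperplanes of a finite matroid, as a finset of flats. -/
noncomputable def hyperplanes (M : Matroid α) [M.Finite] : Finset M.Flats :=
  {H | M.natRk H.1 + 1 = M.natRank}

theorem mem_hyperplanes {H : M.Flats} : H ∈ hyperplanes M ↔ M.natRk H.1 + 1 = M.natRank := by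
  simp [hyperplanes]

theorem coe_subset_of_mem_powersetCard {S : Set α} (hS : S.Finite) {i : ℕ} {t : Finset α}
    (ht : t ∈ hS.toFinset.powersetCard i) : (t : Set α) ⊆ S ∧ (t : Set α).ncard = i := by
  rw [Finset.mem_powersetCard] at ht
  exact ⟨fun x hx => hS.mem_toFinset.1 (ht.1 hx), by rw [Set.ncard_coe_finset, ht.2]⟩

open Classical in
theorem card_flats_of_isPaving (hM : M.IsPaving) {S : Set α} (hS : S ⊆ M.E) {i : ℕ}
    (hi : i + 2 ≤ M.natRank) :
    (Finset.univ.filter fun F : M.Flats => F.1 ⊆ S ∧ M.natRk F.1 = i).card =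
      S.ncard.choose i := by
  have hfin := M.ground_finite.subset hS
  rw [Set.ncard_eq_toFinset_card S hfin, ← Finset.card_powersetCard]
  symm
  refine Finset.card_bij (fun t ht => ⟨t, ?_⟩) (fun t ht => ?_)
    (fun _ _ _ _ h => Finset.coe_injective (congrArg Subtype.val h)) (fun F hF => ?_)
  · obtain ⟨htS, hcard⟩ := coe_subset_of_mem_powersetCard hfin ht
    exact isFlat_of_isPaving hM (htS.trans hS) (hcard ▸ hi)
  · obtain ⟨htS, hcard⟩ := coe_subset_of_mem_powersetCard hfin ht
    refine Finset.mem_filter.2 ⟨Finset.mem_univ _, htS, ?_⟩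
    exact (natRk_eq_ncard_of_indep (indep_of_isPaving hM (htS.trans hS) (by omega))).trans hcard
  · obtain ⟨-, hFS, hrank⟩ := Finset.mem_filter.1 hF
    have hFfin := hfin.subset hFS
    refine ⟨hFfin.toFinset, Finset.mem_powersetCard.2 ⟨?_, ?_⟩, Subtype.ext (by simp)⟩
    · exact Set.Finite.toFinset_subset_toFinset.2 hFS
    · rw [← Set.ncard_eq_toFinset_card _ hFfin, ← hrank,
        natRk_eq_ncard_of_indep (indep_of_isPaving_of_isFlat hM F.2 (by omega))]

open Classical in
theorem sum_flats_of_isPaving {R : Type*} [Semiring R] (hM : M.IsPaving) {S : Set α} (hS : S ⊆ M.E)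
    (φ : ℕ → R) :
    ∑ F : M.Flats with F.1 ⊆ S ∧ M.natRk F.1 + 2 ≤ M.natRank, φ (M.natRk F.1) =
      ∑ i ∈ Finset.range (M.natRank - 1), (S.ncard.choose i : R) * φ i := by
  rw [← Finset.sum_fiberwise_of_maps_to (t := Finset.range (M.natRank - 1))
    (g := fun F : M.Flats => M.natRk F.1)]
  · refine Finset.sum_congr rfl fun i hi => ?_
    have hik := Finset.mem_range.1 hi
    rw [← card_flats_of_isPaving hM hS (i := i) (by omega), ← nsmul_eq_mul, ← Finset.sum_const]
    refine Finset.sum_congr (Finset.ext fun F => ?_) fun F hF => ?_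
    · simp only [Finset.mem_filter, Finset.mem_univ, true_and]
      constructor
      · exact fun h => ⟨h.1.1, h.2⟩
      · exact fun h => ⟨⟨h.1, by omega⟩, h.2⟩
    · rw [(Finset.mem_filter.1 hF).2.2]
  · intro F hF
    have hF := (Finset.mem_filter.1 hF).2.2
    exact Finset.mem_range.2 (by omega)

theorem closure_eq_iff_subset_of_isPaving (hM : M.IsPaving) (hX : X ⊆ M.E)
    (hcard : X.ncard + 1 = M.natRank) (hF : M.IsFlat F) (hrank : M.natRk F + 1 = M.natRank) :
    M.closure X = F ↔ X ⊆ F := by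
  refine ⟨fun h => h ▸ M.subset_closure X hX, fun hXF => ?_⟩
  have hsub : M.closure X ⊆ F := hF.closure ▸ M.closure_subset_closure hXF
  by_contra hne
  have hlt := natRk_lt_of_isFlat (M.isFlat_closure X) (hsub.ssubset_of_ne hne) hF.subset_ground
  rw [Matroid.natRk, Matroid.eRk_closure_eq, ← Matroid.natRk,
    natRk_eq_ncard_of_indep (indep_of_isPaving hM hX (by omega))] at hlt
  omega

/- Every set of `rk M - 1` elements of a paving matroid spans a hyperplane. -/
theorem sum_choose_hyperplanes_of_isPaving (hM : M.IsPaving) (hk : 1 ≤ M.natRank) :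
    ∑ H ∈ hyperplanes M, H.1.ncard.choose (M.natRank - 1) =
      M.E.ncard.choose (M.natRank - 1) := by
  classical
  have hfin := M.ground_finite
  rw [Set.ncard_eq_toFinset_card M.E hfin, ← Finset.card_powersetCard,
    Finset.card_eq_sum_card_fiberwise (t := hyperplanes M)
      (f := fun t : Finset α => (⟨M.closure t, M.isFlat_closure _⟩ : M.Flats))]
  · refine Finset.sum_congr rfl fun H hH => ?_
    have hHfin := hfin.subset H.2.subset_ground
    rw [Set.ncard_eq_toFinset_card H.1 hHfin, ← Finset.card_powersetCard]
    refine congrArg Finset.card (Finset.ext fun t => ?_)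
    rw [Finset.mem_filter, Finset.mem_powersetCard, Finset.mem_powersetCard, and_right_comm,
      and_congr_left_iff]
    intro hcard
    rw [Set.Finite.subset_toFinset, Set.Finite.subset_toFinset, Subtype.ext_iff]
    have hiff (ht : (t : Set α) ⊆ M.E) : M.closure t = H.1 ↔ (t : Set α) ⊆ H.1 :=
      closure_eq_iff_subset_of_isPaving hM ht (by rw [Set.ncard_coe_finset]; omega) H.2
        (mem_hyperplanes.1 hH)
    exact ⟨fun h => ⟨h.trans H.2.subset_ground, (hiff (h.trans H.2.subset_ground)).2 h⟩,
      fun h => (hiff h.1).1 h.2⟩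
  · intro t ht
    obtain ⟨htE, hcard⟩ := coe_subset_of_mem_powersetCard hfin ht
    have hrank := natRk_eq_ncard_of_indep (indep_of_isPaving hM htE (by omega))
    rw [Finset.mem_coe, mem_hyperplanes, Matroid.natRk, Matroid.eRk_closure_eq, ← Matroid.natRk]
    omega

open Classical in
theorem sum_hyperplanes_contract {A : Type*} [AddCommMonoid A] (F : M.Flats) (f : ℕ → A) :
    ∑ G ∈ hyperplanes (M ／ F.1), f G.1.ncard =
      ∑ H ∈ hyperplanes M with F.1 ⊆ H.1, f (H.1.ncard - F.1.ncard) := by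
  have hcontract (G : (M ／ F.1).Flats) :
      ((M ／ F.1).natRk G.1 + 1 = (M ／ F.1).natRank ↔ M.natRk (G.1 ∪ F.1) + 1 = M.natRank) ∧
        (G.1 ∪ F.1).ncard - F.1.ncard = G.1.ncard := by
    have hdisj := ((isFlat_contract_iff F.2.subset_ground).1 G.2).2
    have hrank := natRank_contract_add M F.2.subset_ground
    have hrk := natRk_contract_add M F.1 G.1
    have hcard : (G.1 ∪ F.1).ncard = G.1.ncard + F.1.ncard :=
      Set.ncard_union_eq hdisj ((M ／ F.1).ground_finite.subset G.2.subset_ground)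
        (M.ground_finite.subset F.2.subset_ground)
    omega
  calc ∑ G ∈ hyperplanes (M ／ F.1), f G.1.ncard
      = ∑ G : (M ／ F.1).Flats, if M.natRk (G.1 ∪ F.1) + 1 = M.natRank then
          f ((G.1 ∪ F.1).ncard - F.1.ncard) else 0 := by
        rw [hyperplanes, Finset.sum_filter]
        refine Finset.sum_congr rfl fun G _ => ?_
        rw [(hcontract G).2]
        exact if_congr (hcontract G).1 rfl rfl
    _ = ∑ H : M.Flats with F ≤ H, if M.natRk H.1 + 1 = M.natRank then
          f (H.1.ncard - F.1.ncard) else 0 :=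
        sum_flats_contract M F fun K => if M.natRk K + 1 = M.natRank then
          f (K.ncard - F.1.ncard) else 0
    _ = ∑ H ∈ hyperplanes M with F.1 ⊆ H.1, f (H.1.ncard - F.1.ncard) := by
        rw [hyperplanes, Finset.filter_filter, ← Finset.sum_filter, Finset.filter_filter]
        refine Finset.sum_congr (Finset.filter_congr fun H _ => and_comm) fun _ _ => rfl

end Paving

/-! ### Uniform matroids -/

section Uniform

variable {k n : ℕ}

theorem indep_uniformMatroid_iff {I : Set (Fin n)} : (uniformMatroid k n).Indep I ↔ I.ncard ≤ k :=
  Iff.rfl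

theorem ncard_ground_uniformMatroid (k n : ℕ) : (uniformMatroid k n).E.ncard = n :=
  (Set.ncard_univ _).trans (Nat.card_fin n)

theorem eRank_uniformMatroid (h : k ≤ n) : (uniformMatroid k n).eRank = k := by
  obtain ⟨B, hB⟩ := (uniformMatroid k n).exists_isBase
  rw [← hB.encard_eq_eRank, ← B.toFinite.cast_ncard_eq, (uniformMatroid_isBase_iff h B).1 hB]

theorem natRank_uniformMatroid (h : k ≤ n) : (uniformMatroid k n).natRank = k := by
  exact_mod_cast (cast_natRank _).trans (eRank_uniformMatroid h)

theorem isPaving_uniformMatroid (h : k ≤ n) : (uniformMatroid k n).IsPaving := by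
  intro C hC
  have hcard := not_le.1 (mt indep_uniformMatroid_iff.2 hC.not_indep)
  rw [eRank_uniformMatroid h, ← C.toFinite.cast_ncard_eq]
  exact_mod_cast hcard.le

theorem ncard_of_mem_hyperplanes_uniformMatroid (h : k ≤ n) {H : (uniformMatroid k n).Flats}
    (hH : H ∈ hyperplanes (uniformMatroid k n)) : H.1.ncard + 1 = k := by
  have hrank := mem_hyperplanes.1 hH
  rw [natRank_uniformMatroid h] at hrank
  have hcard : H.1.ncard ≤ k := by
    by_contra! hlt
    obtain ⟨I, hIH, hI⟩ := Set.exists_subset_card_eq hlt.le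
    have hle := natRk_mono (uniformMatroid k n) hIH
    rw [natRk_eq_ncard_of_indep (indep_uniformMatroid_iff.2 hI.le)] at hle
    omega
  rwa [natRk_eq_ncard_of_indep (indep_uniformMatroid_iff.2 hcard)] at hrank

/-- The Kazhdan–Lusztig polynomial of `U_{k,n}`. -/
noncomputable def uniformKL (k n : ℕ) : ℤ[X] := (uniformMatroid k n).klPoly

theorem uniformKL_one (hn : 1 ≤ n) : uniformKL 1 n = 1 := by
  have : (uniformMatroid 1 n).Loopless :=
    Matroid.loopless_iff_forall_isNonloop.2 fun e _ => Matroid.indep_singleton.1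
      (indep_uniformMatroid_iff.2 (Set.ncard_singleton e).le)
  exact klPoly_eq_one _ (by rw [natRank_uniformMatroid hn]; omega)

theorem coeff_uniformKL_eq_zero (h : k ≤ n) {i : ℕ} (hi : i ≠ 0) (hki : k ≤ 2 * i) :
    (uniformKL k n).coeff i = 0 :=
  coeff_klPoly_eq_zero _ hi (by rwa [natRank_uniformMatroid h])

/-- The change of the Kazhdan–Lusztig polynomial of a paving matroid of rank `k` on relaxing a
hyperplane with `h` elements. A hyperplane with `k - 1` elements is independent and does not
contribute. -/
noncomputable def relaxKL (k h : ℕ) : ℤ[X] :=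
  if k ≤ h then uniformKL k (h + 1) - uniformKL (k - 1) h else 0

theorem coeff_relaxKL_eq_zero {h i : ℕ} (hi : i ≠ 0) (hki : k ≤ 2 * i) :
    (relaxKL k h).coeff i = 0 := by
  rw [relaxKL]
  split_ifs with hkh
  · rw [coeff_sub, coeff_uniformKL_eq_zero (by omega) hi hki,
      coeff_uniformKL_eq_zero (by omega) hi (by omega), sub_zero]
  · exact coeff_zero i

theorem relaxKL_pred (hk : 1 ≤ k) : relaxKL k (k - 1) = 0 := if_neg (by omega)

/-- The `Z`-polynomial of `U_{k,n}`, as a sum over the flats grouped by their cardinality. -/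
noncomputable def uniformZ (k n : ℕ) : ℤ[X] :=
  ∑ i ∈ Finset.range k, (n.choose i : ℤ[X]) * (X ^ i * uniformKL (k - i) (n - i)) + X ^ k

theorem uniformZ_eq_sum_range_pred (hk : 1 ≤ k) (hkn : k ≤ n) : uniformZ k n =
    ∑ i ∈ Finset.range (k - 1), (n.choose i : ℤ[X]) * (X ^ i * uniformKL (k - i) (n - i)) +
      (n.choose (k - 1) : ℤ[X]) * X ^ (k - 1) + X ^ k := by
  obtain ⟨k, rfl⟩ := Nat.exists_eq_add_of_le' hk
  rw [uniformZ, Finset.sum_range_succ, Nat.add_sub_cancel, Nat.add_sub_cancel_left,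
    uniformKL_one (by omega), mul_one]

/-- The change of the `Z`-polynomial of a paving matroid of rank `k` on relaxing a hyperplane with
`h` elements. -/
noncomputable def relaxZ (k h : ℕ) : ℤ[X] :=
  ∑ i ∈ Finset.range (k - 1), (h.choose i : ℤ[X]) * (X ^ i * relaxKL (k - i) (h - i)) +
    ((h.choose (k - 1) : ℤ[X]) - 1) * X ^ (k - 1)

theorem relaxZ_pred (k : ℕ) : relaxZ k (k - 1) = 0 := by
  rw [relaxZ, Finset.sum_eq_zero, Nat.choose_self, Nat.cast_one, sub_self, zero_mul, add_zero]
  intro i hi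
  have hik := Finset.mem_range.1 hi
  rw [relaxKL, if_neg (by omega), mul_zero, mul_zero]

theorem uniformZ_succ_succ (hkn : k ≤ n) : uniformZ (k + 1) (n + 1) =
    X * (∑ i ∈ Finset.range k, (n.choose i : ℤ[X]) * (X ^ i * uniformKL (k - i) (n - i))) +
      (∑ i ∈ Finset.range k, (n.choose i : ℤ[X]) * (X ^ i * uniformKL (k - i + 1) (n - i + 1)) +
        (n.choose k : ℤ[X]) * X ^ k) + X ^ (k + 1) := by
  have htop : ∑ i ∈ Finset.range k, (n.choose i : ℤ[X]) *
        (X ^ i * uniformKL (k - i + 1) (n - i + 1)) + (n.choose k : ℤ[X]) * X ^ k =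
      ∑ i ∈ Finset.range (k + 1), (n.choose i : ℤ[X]) *
        (X ^ i * uniformKL (k + 1 - i) (n + 1 - i)) := by
    rw [Finset.sum_range_succ, Nat.add_sub_cancel_left, uniformKL_one (by omega), mul_one]
    congr 1
    refine Finset.sum_congr rfl fun i hi => ?_
    have hik := Finset.mem_range.1 hi
    rw [Nat.sub_add_comm hik.le, Nat.sub_add_comm (hik.le.trans hkn)]
  rw [htop, uniformZ, Finset.sum_range_succ', Finset.sum_range_succ', Finset.mul_sum, ← add_assoc,
    ← Finset.sum_add_distrib]
  congr 2
  · refine Finset.sum_congr rfl fun i _ => ?_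
    rw [Nat.choose_succ_succ, Nat.add_sub_add_right, Nat.add_sub_add_right]
    push_cast
    ring
  · rw [Nat.choose_zero_right, Nat.choose_zero_right, Nat.sub_zero, Nat.sub_zero]

theorem relaxZ_eq_uniformZ_sub (hk : 1 ≤ k) (hkh : k ≤ n) :
    relaxZ k n = uniformZ k (n + 1) - (1 + X) * uniformZ (k - 1) n := by
  obtain ⟨k, rfl⟩ := Nat.exists_eq_add_of_le' hk
  have hrelaxKL : ∑ i ∈ Finset.range k, (n.choose i : ℤ[X]) *
        (X ^ i * relaxKL (k + 1 - i) (n - i)) =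
      ∑ i ∈ Finset.range k, (n.choose i : ℤ[X]) * (X ^ i * uniformKL (k - i + 1) (n - i + 1)) -
        ∑ i ∈ Finset.range k, (n.choose i : ℤ[X]) * (X ^ i * uniformKL (k - i) (n - i)) := by
    rw [← Finset.sum_sub_distrib]
    refine Finset.sum_congr rfl fun i hi => ?_
    have hik := Finset.mem_range.1 hi
    rw [relaxKL, if_pos (by omega), Nat.sub_add_comm hik.le, Nat.add_sub_cancel]
    ring
  rw [uniformZ_succ_succ (by omega), relaxZ, Nat.add_sub_cancel, hrelaxKL, uniformZ]
  ring

end Uniform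

/-! ### Kazhdan–Lusztig polynomials of paving matroids -/

section PavingKL

universe u

variable {α : Type u} {M : Matroid α} [M.Finite]

theorem zPoly_eq_sum_add_hyperplanes (M : Matroid α) [M.Finite] : M.zPoly =
    ∑ F : M.Flats with M.natRk F.1 + 2 ≤ M.natRank, X ^ M.natRk F.1 * (M ／ F.1).klPoly +
      ((hyperplanes M).card : ℤ[X]) * X ^ (M.natRank - 1) + X ^ M.natRank := by
  classical
  set E : M.Flats := ⟨M.E, M.ground_isFlat⟩
  have hE : X ^ M.natRk E.1 * (M ／ E.1).klPoly = X ^ M.natRank := by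
    rw [klPoly_of_ground_eq_empty (by simp [E]), mul_one, Matroid.natRank]
  have hhyp : ∀ H ∈ hyperplanes M, X ^ M.natRk H.1 * (M ／ H.1).klPoly = X ^ (M.natRank - 1) := by
    intro H hH
    have hrk := mem_hyperplanes.1 hH
    have hrank := natRank_contract_add M H.2.subset_ground
    have := loopless_contract H.2
    rw [klPoly_eq_one _ (by omega), mul_one, ← hrk, Nat.add_sub_cancel]
  have hrest : (Finset.univ.filter fun F : M.Flats => ¬ M.natRk F.1 + 2 ≤ M.natRank) =
      insert E (hyperplanes M) := by
    ext F
    rw [Finset.mem_filter_univ, Finset.mem_insert, mem_hyperplanes]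
    rcases eq_or_ne F E with rfl | hF
    · exact iff_of_true (by rw [← Matroid.natRank]; omega) (Or.inl rfl)
    · have hlt : M.natRk F.1 < M.natRank := natRk_lt_of_isFlat F.2
        (F.2.subset_ground.ssubset_of_ne fun h => hF (Subtype.ext h)) subset_rfl
      simp only [hF, false_or]
      omega
  have hEnot : E ∉ hyperplanes M := fun h => by
    have := mem_hyperplanes.1 h
    rw [← Matroid.natRank] at this
    omega
  rw [Matroid.zPoly, ← Finset.sum_filter_add_sum_filter_not _
    fun F : M.Flats => M.natRk F.1 + 2 ≤ M.natRank, hrest, Finset.sum_insert hEnot, hE,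
    Finset.sum_congr rfl hhyp, Finset.sum_const, nsmul_eq_mul]
  ring

/-- The Kazhdan–Lusztig polynomial of a paving matroid of rank at least `2` according to
`klPoly_eq_pavingKL`: that of the uniform matroid, corrected for each hyperplane. -/
noncomputable def pavingKL (M : Matroid α) [M.Finite] : ℤ[X] :=
  uniformKL M.natRank M.E.ncard - ∑ H ∈ hyperplanes M, relaxKL M.natRank H.1.ncard

/-- The analogue of `pavingKL` for the `Z`-polynomial. -/
noncomputable def pavingZ (M : Matroid α) [M.Finite] : ℤ[X] :=
  uniformZ M.natRank M.E.ncard - ∑ H ∈ hyperplanes M, relaxZ M.natRank H.1.ncard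

open Classical in
theorem pavingKL_contract (hM : M.IsPaving) (F : M.Flats) (hF : M.natRk F.1 + 2 ≤ M.natRank) :
    pavingKL (M ／ F.1) =
      uniformKL (M.natRank - M.natRk F.1) (M.E.ncard - M.natRk F.1) -
        ∑ H ∈ hyperplanes M with F.1 ⊆ H.1,
          relaxKL (M.natRank - M.natRk F.1) (H.1.ncard - M.natRk F.1) := by
  have hrank := natRank_contract_add M F.2.subset_ground
  rw [pavingKL, sum_hyperplanes_contract F (relaxKL _), Matroid.contract_ground,
    Set.ncard_sdiff F.2.subset_ground (M.ground_finite.subset F.2.subset_ground),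
    ← natRk_eq_ncard_of_indep (indep_of_isPaving_of_isFlat hM F.2 hF), ← hrank,
    Nat.add_sub_cancel]

theorem pavingZ_eq_sum_add_hyperplanes (hM : M.IsPaving) (hk : 1 ≤ M.natRank) : pavingZ M =
    ∑ F : M.Flats with M.natRk F.1 + 2 ≤ M.natRank, X ^ M.natRk F.1 * pavingKL (M ／ F.1) +
      ((hyperplanes M).card : ℤ[X]) * X ^ (M.natRank - 1) + X ^ M.natRank := by
  classical
  set k := M.natRank
  have huniform : ∑ F : M.Flats with M.natRk F.1 + 2 ≤ k,
        X ^ M.natRk F.1 * uniformKL (k - M.natRk F.1) (M.E.ncard - M.natRk F.1) =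
      ∑ i ∈ Finset.range (k - 1),
        (M.E.ncard.choose i : ℤ[X]) * (X ^ i * uniformKL (k - i) (M.E.ncard - i)) := by
    rw [← sum_flats_of_isPaving hM subset_rfl fun i => X ^ i * uniformKL (k - i) (M.E.ncard - i)]
    exact Finset.sum_congr (Finset.filter_congr fun F _ =>
      (and_iff_right F.2.subset_ground).symm) fun _ _ => rfl
  have hrelax : ∑ F : M.Flats with M.natRk F.1 + 2 ≤ k, X ^ M.natRk F.1 *
        ∑ H ∈ hyperplanes M with F.1 ⊆ H.1, relaxKL (k - M.natRk F.1) (H.1.ncard - M.natRk F.1) =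
      ∑ H ∈ hyperplanes M, ∑ i ∈ Finset.range (k - 1),
        (H.1.ncard.choose i : ℤ[X]) * (X ^ i * relaxKL (k - i) (H.1.ncard - i)) := by
    simp only [Finset.mul_sum]
    rw [Finset.sum_comm' (t' := hyperplanes M) (s' := fun H : M.Flats =>
      Finset.univ.filter fun F : M.Flats => F.1 ⊆ H.1 ∧ M.natRk F.1 + 2 ≤ k)]
    · exact Finset.sum_congr rfl fun H _ => sum_flats_of_isPaving hM H.2.subset_ground
        fun i => X ^ i * relaxKL (k - i) (H.1.ncard - i)
    · intro F H
      simp only [Finset.mem_filter, Finset.mem_univ, true_and]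
      tauto
  have hcard : (M.E.ncard.choose (k - 1) : ℤ[X]) =
      ∑ H ∈ hyperplanes M, (H.1.ncard.choose (k - 1) : ℤ[X]) := by
    exact_mod_cast (sum_choose_hyperplanes_of_isPaving hM hk).symm
  rw [Finset.sum_congr rfl fun F hF =>
      congrArg _ (pavingKL_contract hM F (Finset.mem_filter.1 hF).2)]
  simp only [mul_sub, Finset.sum_sub_distrib]
  rw [huniform, hrelax, pavingZ, uniformZ_eq_sum_range_pred hk (natRk_le_ncard M subset_rfl), hcard]
  simp only [relaxZ, Finset.sum_add_distrib, ← Finset.sum_mul, Finset.sum_sub_distrib,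
    Finset.sum_const, nsmul_eq_mul, mul_one]
  ring

/-- The formula `klPoly_eq_pavingKL` for ranks below `k`: the hypothesis of an induction. -/
def PavingKLBelow (k : ℕ) : Prop :=
  ∀ (α : Type u) (M : Matroid α) [M.Finite], M.IsPaving → 2 ≤ M.natRank → M.natRank < k →
    M.klPoly = pavingKL M

theorem klPoly_sub_pavingKL_eq (hM : M.IsPaving) (hk : 2 ≤ M.natRank)
    (ih : PavingKLBelow.{u} M.natRank) :
    M.klPoly - pavingKL M = M.zPoly - pavingZ M := by
  classical
  have := loopless_of_isPaving hM hk
  have hbot : pavingKL (M ／ M.botFlat.1) = pavingKL M := by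
    rw [pavingKL_contract hM _ (by rw [natRk_botFlat]; omega), natRk_botFlat, pavingKL,
      Finset.filter_true_of_mem (p := fun H : M.Flats => M.botFlat.1 ⊆ H.1)
        fun H _ => botFlat_le M H]
    rfl
  rw [zPoly_eq_sum_add_hyperplanes, pavingZ_eq_sum_add_hyperplanes hM (by omega),
    add_sub_add_right_eq_sub, add_sub_add_right_eq_sub, ← Finset.sum_sub_distrib,
    Finset.sum_eq_single_of_mem M.botFlat
      (Finset.mem_filter.2 ⟨Finset.mem_univ _, by rw [natRk_botFlat]; omega⟩),
    natRk_botFlat, pow_zero, one_mul, one_mul, klPoly_contract_botFlat, hbot]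
  intro F hF hne
  have hrk := (Finset.mem_filter.1 hF).2
  have hpos : 0 < M.natRk F.1 := natRk_botFlat M ▸ natRk_lt_of_isFlat M.botFlat.2
    ((botFlat_le M F).lt_of_ne hne.symm) F.2.subset_ground
  have hrank := natRank_contract_add M F.2.subset_ground
  rw [ih α (M ／ F.1) (isPaving_contract hM (indep_of_isPaving_of_isFlat hM F.2 hrk)) (by omega)
    (by omega), sub_self]

theorem pavingKL_uniformMatroid {k n : ℕ} (hk : 1 ≤ k) (hkn : k ≤ n) :
    pavingKL (uniformMatroid k n) = (uniformMatroid k n).klPoly := by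
  rw [pavingKL, natRank_uniformMatroid hkn, ncard_ground_uniformMatroid, uniformKL, sub_eq_self]
  refine Finset.sum_eq_zero fun H hH => ?_
  rw [Nat.eq_sub_of_add_eq (ncard_of_mem_hyperplanes_uniformMatroid hkn hH), relaxKL_pred hk]

theorem pavingZ_uniformMatroid {k n : ℕ} (hkn : k ≤ n) :
    pavingZ (uniformMatroid k n) = uniformZ k n := by
  rw [pavingZ, natRank_uniformMatroid hkn, ncard_ground_uniformMatroid, sub_eq_self]
  refine Finset.sum_eq_zero fun H hH => ?_
  rw [Nat.eq_sub_of_add_eq (ncard_of_mem_hyperplanes_uniformMatroid hkn hH), relaxZ_pred]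

theorem zPoly_eq_pavingZ_of_natRank_le_one (hM : M.IsPaving) (hk : M.natRank ≤ 1) :
    M.zPoly = pavingZ M := by
  have hempty : (Finset.univ.filter fun F : M.Flats => M.natRk F.1 + 2 ≤ M.natRank) = ∅ :=
    Finset.filter_false_of_mem fun F _ => by omega
  rw [zPoly_eq_sum_add_hyperplanes, hempty]
  rcases Nat.le_one_iff_eq_zero_or_eq_one.1 hk with hk | hk
  · have hhyp : hyperplanes M = ∅ := Finset.eq_empty_of_forall_notMem fun H hH => by
      have hrk := mem_hyperplanes.1 hH
      omega
    simp [pavingZ, uniformZ, hhyp, hk]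
  · rw [pavingZ_eq_sum_add_hyperplanes hM hk.ge, hempty, Finset.sum_empty, Finset.sum_empty]

theorem zPoly_uniformMatroid_of_below {k n : ℕ} (hkn : k ≤ n) (ih : PavingKLBelow.{0} k) :
    (uniformMatroid k n).zPoly = uniformZ k n := by
  have hrank := natRank_uniformMatroid hkn
  rw [← pavingZ_uniformMatroid hkn]
  rcases Nat.lt_or_ge 1 k with hk | hk
  · have h := klPoly_sub_pavingKL_eq (isPaving_uniformMatroid hkn) (by omega) (by rwa [hrank])
    rw [pavingKL_uniformMatroid hk.le hkn, sub_self] at h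
    exact sub_eq_zero.1 h.symm
  · exact zPoly_eq_pavingZ_of_natRank_le_one (isPaving_uniformMatroid hkn) (by omega)

theorem reflect_relaxZ_of_below {k h : ℕ} (hk : 1 ≤ k) (hkh : k ≤ h + 1)
    (ih : PavingKLBelow.{0} k) : (relaxZ k h).reflect k = relaxZ k h := by
  rcases hkh.eq_or_lt with rfl | hkh
  · have hzero : relaxZ (h + 1) h = 0 := relaxZ_pred (h + 1)
    rw [hzero, reflect_zero]
  obtain ⟨k, rfl⟩ := Nat.exists_eq_add_of_le' hk
  have hZ : (uniformZ (k + 1) (h + 1)).reflect (k + 1) = uniformZ (k + 1) (h + 1) := by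
    have hreflect := reflect_zPoly (uniformMatroid (k + 1) (h + 1))
    rwa [natRank_uniformMatroid (by omega),
      zPoly_uniformMatroid_of_below (by omega) ih] at hreflect
  have hZpred : ((1 + X) * uniformZ k h).reflect (k + 1) = (1 + X) * uniformZ k h := by
    have hreflect := reflect_zPoly (uniformMatroid k h)
    have hdeg := natDegree_zPoly (uniformMatroid k h)
    rw [natRank_uniformMatroid (by omega), zPoly_uniformMatroid_of_below (by omega)
      fun α M _ hM hM2 hMk => ih α M hM hM2 (by omega)] at hreflect hdeg
    exact reflect_one_add_X_mul hreflect hdeg.le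
  rw [relaxZ_eq_uniformZ_sub (by omega) (by omega), Nat.add_sub_cancel, reflect_sub, hZ, hZpred]

/- `M.klPoly - pavingKL M` has no coefficients in degrees `≥ k / 2`, so being palindromic of
degree `k` it vanishes. -/
theorem klPoly_eq_pavingKL_of_below (hM : M.IsPaving) (hk : 2 ≤ M.natRank)
    (ih₀ : PavingKLBelow.{0} M.natRank) (ih : PavingKLBelow.{u} M.natRank) :
    M.klPoly = pavingKL M := by
  have hn : M.natRank ≤ M.E.ncard := natRk_le_ncard M subset_rfl
  have hpavingZ : (pavingZ M).reflect M.natRank = pavingZ M := by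
    have hU := reflect_zPoly (uniformMatroid M.natRank M.E.ncard)
    rw [natRank_uniformMatroid hn, zPoly_uniformMatroid_of_below hn ih₀] at hU
    rw [pavingZ, reflect_sub, hU, reflect_sum]
    refine congrArg _ (Finset.sum_congr rfl fun H hH => reflect_relaxZ_of_below (by omega) ?_ ih₀)
    have hrk := mem_hyperplanes.1 hH
    have hcard := natRk_le_ncard M H.2.subset_ground
    omega
  refine sub_eq_zero.1 (ext_of_reflect_eq_self (k := M.natRank) ?_ reflect_zero fun i hi => ?_)
  · rw [klPoly_sub_pavingKL_eq hM hk ih, reflect_sub, reflect_zPoly, hpavingZ]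
  · have hi0 : i ≠ 0 := by omega
    rw [coeff_sub, coeff_klPoly_eq_zero M hi0 hi, pavingKL, coeff_sub,
      coeff_uniformKL_eq_zero hn hi0 hi, finsetSum_coeff,
      Finset.sum_eq_zero fun H _ => coeff_relaxKL_eq_zero hi0 hi, coeff_zero, sub_zero, sub_zero]

theorem pavingKLBelow_zero_and (k : ℕ) : PavingKLBelow.{0} k ∧ PavingKLBelow.{u} k := by
  induction k using Nat.strong_induction_on with
  | _ k ih =>
  exact ⟨fun α M _ hM hM2 hMk => klPoly_eq_pavingKL_of_below hM hM2 (ih _ hMk).1 (ih _ hMk).1,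
    fun α M _ hM hM2 hMk => klPoly_eq_pavingKL_of_below hM hM2 (ih _ hMk).1 (ih _ hMk).2⟩

theorem klPoly_eq_pavingKL (hM : M.IsPaving) (hk : 2 ≤ M.natRank) : M.klPoly = pavingKL M :=
  (pavingKLBelow_zero_and _).2 α M hM hk (Nat.lt_succ_self _)

theorem zPoly_eq_pavingZ (hM : M.IsPaving) : M.zPoly = pavingZ M := by
  rcases Nat.lt_or_ge 1 M.natRank with hk | hk
  · have h := klPoly_sub_pavingKL_eq hM hk (pavingKLBelow_zero_and _).2
    rw [klPoly_eq_pavingKL hM hk, sub_self] at h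
    exact sub_eq_zero.1 h.symm
  · exact zPoly_eq_pavingZ_of_natRank_le_one hM hk

theorem zPoly_uniformMatroid {k n : ℕ} (hkn : k ≤ n) : (uniformMatroid k n).zPoly = uniformZ k n :=
  zPoly_uniformMatroid_of_below hkn (pavingKLBelow_zero_and.{0} k).1

theorem reflect_relaxZ {k h : ℕ} (hk : 1 ≤ k) (hkh : k ≤ h + 1) :
    (relaxZ k h).reflect k = relaxZ k h :=
  reflect_relaxZ_of_below hk hkh (pavingKLBelow_zero_and.{0} k).1

end PavingKL

/-! ### The polynomials `g` -/

theorem gamma_eq_gammaOfDegree {α : Type*} (M : Matroid α) [M.Finite] :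
    M.gamma = gammaOfDegree M.natRank M.zPoly := by
  rw [Matroid.gamma, gammaPoly_eq_gammaOfDegree, natDegree_zPoly]

theorem gamma_uniformMatroid {k n : ℕ} (hkn : k ≤ n) :
    (uniformMatroid k n).gamma = gammaOfDegree k (uniformZ k n) := by
  rw [gamma_eq_gammaOfDegree, natRank_uniformMatroid hkn, zPoly_uniformMatroid hkn]

theorem gPoly_eq_gammaOfDegree {k h : ℕ} (hk : 1 ≤ k) (hkh : k ≤ h) :
    gPoly k h = gammaOfDegree k (relaxZ k h) := by
  obtain ⟨k, rfl⟩ := Nat.exists_eq_add_of_le' hk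
  have hrank := natRank_uniformMatroid (k := k) (n := h) (by omega)
  have hreflect := reflect_zPoly (uniformMatroid k h)
  have hdeg := natDegree_zPoly (uniformMatroid k h)
  rw [hrank, zPoly_uniformMatroid (by omega)] at hreflect hdeg
  have hgamma : (uniformMatroid (k + 1 - 1) h).gamma = gammaOfDegree k (uniformZ k h) :=
    gamma_uniformMatroid (by omega)
  rw [gPoly, gamma_uniformMatroid (by omega), hgamma, relaxZ_eq_uniformZ_sub hk hkh,
    Nat.add_sub_cancel, map_sub, gammaOfDegree_one_add_X_mul hreflect hdeg]

theorem numHyperplanes_eq_card {α : Type*} (M : Matroid α) [M.Finite] (h : ℕ) :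
    M.numHyperplanes h = ((hyperplanes M).filter fun H => H.1.ncard = h).card := by
  rw [Matroid.numHyperplanes, ← Set.ncard_coe_finset,
    ← Set.ncard_image_of_injective _ Subtype.val_injective]
  congr 1
  ext H
  simp only [Set.mem_ofPred_eq, Set.mem_image, Finset.mem_coe, Finset.mem_filter, mem_hyperplanes,
    Subtype.exists, exists_and_right, exists_eq_right, Matroid.IsHyperplaneFlat,
    ← cast_natRank, ← cast_natRk, exists_prop]
  norm_cast
  refine and_congr_right fun hH => ?_
  rw [← (M.ground_finite.subset hH.1.subset_ground).cast_ncard_eq, Nat.cast_inj]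

theorem gamma_eq_sub_sum_of_isPaving {α : Type*} {M : Matroid α} [M.Finite] (hM : M.IsPaving) :
    M.gamma = (uniformMatroid M.natRank M.E.ncard).gamma -
      ∑ h ∈ Finset.Icc M.natRank M.E.ncard, M.numHyperplanes h • gPoly M.natRank h := by
  have hn : M.natRank ≤ M.E.ncard := natRk_le_ncard M subset_rfl
  have hg : ∀ H ∈ hyperplanes M, gammaOfDegree M.natRank (relaxZ M.natRank H.1.ncard) =
      if M.natRank ≤ H.1.ncard then gPoly M.natRank H.1.ncard else 0 := by
    intro H hH
    have hrk := mem_hyperplanes.1 hH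
    have hcard := natRk_le_ncard M H.2.subset_ground
    split_ifs with hkh
    · exact (gPoly_eq_gammaOfDegree (by omega) hkh).symm
    · rw [show H.1.ncard = M.natRank - 1 by omega, relaxZ_pred, map_zero]
  rw [gamma_eq_gammaOfDegree, zPoly_eq_pavingZ hM, pavingZ, map_sub, map_sum,
    ← gamma_uniformMatroid hn, Finset.sum_congr rfl hg,
    ← Finset.sum_filter, ← Finset.sum_fiberwise_of_maps_to (t := Finset.Icc M.natRank M.E.ncard)
      (g := fun H : M.Flats => H.1.ncard)]
  · refine congrArg _ (Finset.sum_congr rfl fun h hh => ?_)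
    have hkh := (Finset.mem_Icc.1 hh).1
    rw [numHyperplanes_eq_card, ← Finset.sum_const, Finset.filter_filter]
    refine Finset.sum_congr (Finset.filter_congr fun H _ => ?_) fun H hH => ?_
    · exact and_iff_right_of_imp fun hH => hH ▸ hkh
    · rw [(Finset.mem_filter.1 hH).2]
  · exact fun H hH => Finset.mem_Icc.2 ⟨(Finset.mem_filter.1 hH).2,
      Set.ncard_le_ncard H.2.subset_ground M.ground_finite⟩

/-! ### The coefficients of `g` -/

theorem relaxKL_one {h : ℕ} (hh : 1 ≤ h) : relaxKL 1 h = 1 := by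
  have hloop : ¬ (uniformMatroid 0 h).Loopless := fun hM => by
    have hindep := Matroid.indep_singleton.2 (Matroid.loopless_iff_forall_isNonloop.1 hM
      (⟨0, hh⟩ : Fin h) (Set.mem_univ _))
    rw [indep_uniformMatroid_iff, Set.ncard_singleton] at hindep
    omega
  have hzero : uniformKL 0 h = 0 := klPoly_of_not_loopless hloop
  rw [relaxKL, if_pos hh, uniformKL_one (by omega), hzero, sub_zero]

theorem relaxZ_eq_sum_sub {k h : ℕ} (hk : 1 ≤ k) (hkh : k ≤ h) : relaxZ k h =
    ∑ i ∈ Finset.range k, (h.choose i : ℤ[X]) * (X ^ i * relaxKL (k - i) (h - i)) -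
      X ^ (k - 1) := by
  obtain ⟨k, rfl⟩ := Nat.exists_eq_add_of_le' hk
  rw [relaxZ, Finset.sum_range_succ, Nat.add_sub_cancel, Nat.add_sub_cancel_left,
    relaxKL_one (by omega)]
  ring

theorem sum_neg_one_pow_choose_mul_sum_choose {R : Type*} [CommRing R] {k : ℕ} (n : ℕ) (hk : 1 ≤ k)
    (x : R) (q : ℕ → R) :
    ∑ i ∈ Finset.range k, (-1) ^ i * (n.choose i : R) * x ^ i *
      ∑ l ∈ Finset.range (k - i), ((n - i).choose l : R) * (x ^ l * q (k - i - l)) = q k := by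
  have hdiag : ∀ s, ∑ i ∈ Finset.range (s + 1),
      (-1) ^ i * (n.choose i : R) * x ^ i * (((n - i).choose (s - i) : R) *
        (x ^ (s - i) * q (k - i - (s - i)))) = if s = 0 then q k else 0 := by
    intro s
    have hterm : ∀ i ∈ Finset.range (s + 1),
        (-1) ^ i * (n.choose i : R) * x ^ i * (((n - i).choose (s - i) : R) *
          (x ^ (s - i) * q (k - i - (s - i)))) =
        (((-1) ^ i * (s.choose i : ℤ) : ℤ) : R) * ((n.choose s : R) * (x ^ s * q (k - s))) := by
      intro i hi
      have his := Finset.mem_range_succ_iff.1 hi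
      have hchoose : (n.choose i : R) * ((n - i).choose (s - i) : R) =
          (n.choose s : R) * (s.choose i : R) :=
        mod_cast congrArg Nat.cast (Nat.choose_mul his).symm
      rw [Nat.sub_sub, Nat.add_sub_cancel' his, ← Nat.add_sub_cancel' his, pow_add,
        Nat.add_sub_cancel' his]
      push_cast
      linear_combination (-1) ^ i * x ^ i * x ^ (s - i) * q (k - s) * hchoose
    rw [Finset.sum_congr rfl hterm, ← Finset.sum_mul, ← Int.cast_sum,
      Int.alternating_sum_range_choose]
    split_ifs with hs
    · simp [hs]
    · rw [Int.cast_zero, zero_mul]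
  simp only [Finset.mul_sum]
  rw [← Finset.sum_range_diag_flip k fun i l => (-1) ^ i * (n.choose i : R) * x ^ i *
    (((n - i).choose l : R) * (x ^ l * q (k - i - l))), Finset.sum_congr rfl fun s _ => hdiag s,
    Finset.sum_ite_eq', if_pos (Finset.mem_range.2 hk)]

theorem sum_neg_one_pow_choose_mul_X_pow_mul_relaxZ {k : ℕ} (m : ℕ) (hk : 1 ≤ k) :
    ∑ i ∈ Finset.range k, C ((-1) ^ i * ((k + m).choose i : ℤ)) *
        (X ^ i * relaxZ (k - i) (k - i + m)) =
      relaxKL k (k + m) - C ((-1) ^ (k - 1) * ((k + m - 1).choose (k - 1) : ℤ)) * X ^ (k - 1) := by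
  have hinv := sum_neg_one_pow_choose_mul_sum_choose (k + m) hk (X : ℤ[X])
    fun j => relaxKL j (j + m)
  have halt := Int.alternating_sum_range_choose_eq_choose (n := k + m - 1) (m := k - 1)
  rw [Nat.sub_add_cancel hk, Nat.sub_add_cancel (by omega : 1 ≤ k + m)] at halt
  rw [← hinv, ← halt, map_sum, Finset.sum_mul, ← Finset.sum_sub_distrib]
  refine Finset.sum_congr rfl fun i hi => ?_
  have hik := Finset.mem_range.1 hi
  have hinner : ∑ l ∈ Finset.range (k - i), ((k - i + m).choose l : ℤ[X]) *
        (X ^ l * relaxKL (k - i - l) (k - i + m - l)) =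
      ∑ l ∈ Finset.range (k - i), ((k + m - i).choose l : ℤ[X]) *
        (X ^ l * relaxKL (k - i - l) (k - i - l + m)) := by
    refine Finset.sum_congr rfl fun l hl => ?_
    have hlk := Finset.mem_range.1 hl
    rw [show k - i + m = k + m - i by omega, show k + m - i - l = k - i - l + m by omega]
  rw [relaxZ_eq_sum_sub (by omega) (Nat.le_add_right _ m), hinner,
    show k - 1 = i + (k - i - 1) by omega, pow_add]
  simp only [map_mul, map_pow, map_neg, map_one, map_natCast]
  ring

theorem natDegree_relaxZ_le {k h : ℕ} (hk : 1 ≤ k) (hkh : k ≤ h) : (relaxZ k h).natDegree ≤ k := by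
  have hdeg : ∀ {k n}, k ≤ n → (uniformZ k n).natDegree = k := fun hkn => by
    rw [← zPoly_uniformMatroid hkn, natDegree_zPoly, natRank_uniformMatroid hkn]
  rw [relaxZ_eq_uniformZ_sub hk hkh]
  refine (natDegree_sub_le _ _).trans (max_le (hdeg (by omega)).le (natDegree_mul_le.trans ?_))
  have hlin : (1 + X : ℤ[X]).natDegree ≤ 1 := by compute_degree
  rw [hdeg (by omega)]
  omega

theorem sum_neg_one_pow_choose_mul_relaxZ {k : ℕ} (m : ℕ) (hk : 1 ≤ k) :
    ∑ i ∈ Finset.range k, C ((-1) ^ i * ((k + m).choose i : ℤ)) * relaxZ (k - i) (k - i + m) =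
      (relaxKL k (k + m)).reflect k -
        C ((-1) ^ (k - 1) * ((k + m - 1).choose (k - 1) : ℤ)) * X := by
  have h := congrArg (reflect k) (sum_neg_one_pow_choose_mul_X_pow_mul_relaxZ m hk)
  rw [reflect_sum, reflect_sub, reflect_C_mul_X_pow, revAt_le (Nat.sub_le k 1),
    Nat.sub_sub_self hk, pow_one] at h
  rw [← h]
  refine Finset.sum_congr rfl fun i hi => ?_
  have hik := Finset.mem_range.1 hi
  have hX : reflect i (X ^ i : ℤ[X]) = 1 := by
    rw [reflect_monomial, revAt_le le_rfl, Nat.sub_self, pow_zero]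
  have hrefl : reflect (i + (k - i)) (X ^ i * relaxZ (k - i) (k - i + m)) =
      relaxZ (k - i) (k - i + m) := by
    rw [reflect_mul _ _ (natDegree_X_pow_le i) (natDegree_relaxZ_le (by omega) (by omega)), hX,
      one_mul, reflect_relaxZ (by omega) (by omega)]
  rw [Nat.add_sub_cancel' hik.le] at hrefl
  rw [reflect_C_mul, hrefl]

theorem sum_neg_one_pow_choose_mul_coeff_relaxZ {k m b : ℕ} (hk : 2 ≤ k) (hb : 2 * b ≤ k) :
    ∑ i ∈ Finset.range k, (-1 : ℤ) ^ i * ((k + m).choose i : ℤ) *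
      (relaxZ (k - i) (k - i + m)).coeff b =
      if b = 1 then (-1) ^ k * ((k + m - 1).choose (k - 1) : ℤ) else 0 := by
  have h := congrArg (coeff · b) (sum_neg_one_pow_choose_mul_relaxZ m (by omega : 1 ≤ k))
  simp only [finsetSum_coeff, coeff_C_mul, coeff_sub, coeff_reflect, coeff_X] at h
  rw [h, revAt_le (by omega), coeff_relaxKL_eq_zero (by omega) (by omega)]
  obtain ⟨k, rfl⟩ := Nat.exists_eq_add_of_le' hk
  rcases eq_or_ne b 1 with rfl | hb1
  · simp [pow_succ]
  · simp [hb1, hb1.symm]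

theorem natDegree_relaxZClosed_le (m k : ℕ) : (relaxZClosed m k).natDegree ≤ k := by
  refine natDegree_sum_le_of_forall_le _ _ fun l hl => (natDegree_C_mul_le _ _).trans ?_
  have hlk := Finset.mem_range.1 hl
  have hlin : ((1 + X : ℚ[X]) ^ (k - 2 * (l + 1))).natDegree ≤ k - 2 * (l + 1) := by compute_degree
  refine natDegree_mul_le.trans ?_
  rw [natDegree_X_pow]
  omega

theorem reflect_relaxZClosed (m k : ℕ) : (relaxZClosed m k).reflect k = relaxZClosed m k := by
  rw [relaxZClosed, reflect_sum]
  refine Finset.sum_congr rfl fun l hl => ?_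
  have hlk := Finset.mem_range.1 hl
  rw [reflect_C_mul, reflect_X_pow_mul_one_add_X_pow (by omega)]

/- The sums in `sum_neg_one_pow_choose_mul_coeff_relaxZ` determine the low coefficients of the
`relaxZ k (k + m)` recursively, and palindromicity determines the others. -/
theorem map_relaxZ {k : ℕ} (m : ℕ) (hk : 1 ≤ k) :
    (relaxZ k (k + m)).map (Int.castRingHom ℚ) = relaxZClosed m k := by
  induction k using Nat.strong_induction_on with
  | _ k ih =>
  rcases hk.eq_or_lt with rfl | hk2
  · simp [relaxZ, relaxZClosed]
  have hlow : ∀ b, 2 * b ≤ k → ((relaxZ k (k + m)).coeff b : ℚ) = (relaxZClosed m k).coeff b := by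
    intro b hb
    have hsum := congrArg (Int.cast (R := ℚ)) (sum_neg_one_pow_choose_mul_coeff_relaxZ (m := m)
      hk2 hb)
    push_cast at hsum
    rw [← sum_neg_one_pow_choose_mul_coeff_relaxZClosed hk2 hb] at hsum
    have hsmaller : ∀ i ∈ Finset.range k \ {0},
      ((relaxZ (k - i) (k - i + m)).coeff b : ℚ) = (relaxZClosed m (k - i)).coeff b := by
      intro i hi
      simp only [Finset.mem_sdiff, Finset.mem_range, Finset.mem_singleton] at hi
      rw [← ih (k - i) (by omega) (by omega), coeff_map, eq_intCast]
    rw [← Finset.sum_sdiff (Finset.singleton_subset_iff.2 (Finset.mem_range.2 hk)),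
      Finset.sum_congr rfl fun i hi => by rw [hsmaller i hi],
      ← Finset.sum_sdiff (Finset.singleton_subset_iff.2 (Finset.mem_range.2 hk))] at hsum
    simpa using hsum
  have hreflect : ((relaxZ k (k + m)).map (Int.castRingHom ℚ)).reflect k =
      (relaxZ k (k + m)).map (Int.castRingHom ℚ) := by
    rw [reflect_map, reflect_relaxZ hk (by omega)]
  refine ext_of_reflect_eq_self hreflect (reflect_relaxZClosed m k) fun i hi => ?_
  rcases le_or_gt i k with hik | hki
  · rw [← coeff_sub_of_reflect_eq_self hreflect hik,
      ← coeff_sub_of_reflect_eq_self (reflect_relaxZClosed m k) hik, coeff_map, eq_intCast,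
      hlow (k - i) (by omega)]
  · rw [coeff_map, coeff_eq_zero_of_natDegree_lt
      ((natDegree_relaxZ_le hk (Nat.le_add_right k m)).trans_lt hki), map_zero,
      coeff_eq_zero_of_natDegree_lt ((natDegree_relaxZClosed_le m k).trans_lt hki)]

theorem cast_gammaCoeff_relaxZ {k : ℕ} (m i : ℕ) (hk : 1 ≤ k) :
    (gammaCoeff (relaxZ k (k + m)) k i : ℚ) =
      if i = 0 ∨ k / 2 < i then 0 else relaxGamma (i - 1) m k := by
  have hexp : (relaxZ k (k + m)).map (Int.castRingHom ℚ) = ∑ i ∈ Finset.range (k / 2 + 1),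
      C (if i = 0 then 0 else relaxGamma (i - 1) m k) * (X ^ i * (1 + X) ^ (k - 2 * i)) := by
    rw [map_relaxZ m hk, relaxZClosed, Finset.sum_range_succ']
    simp
  rw [cast_gammaCoeff hexp]
  grind

theorem coeff_zero_gPoly {k h : ℕ} (hk : 1 ≤ k) (hkh : k ≤ h) : (gPoly k h).coeff 0 = 0 := by
  obtain ⟨m, rfl⟩ := Nat.exists_eq_add_of_le hkh
  have hcoeff := cast_gammaCoeff_relaxZ m 0 hk
  rw [if_pos (Or.inl rfl)] at hcoeff
  rw [gPoly_eq_gammaOfDegree hk hkh, coeff_gammaOfDegree, if_pos (Nat.zero_le _)]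
  exact_mod_cast hcoeff

theorem cast_coeff_succ_gPoly {k h : ℕ} (hk : 1 ≤ k) (hkh : k ≤ h) (l : ℕ) :
    ((gPoly k h).coeff (l + 1) : ℚ) = relaxGamma l (h - k) k := by
  obtain ⟨m, rfl⟩ := Nat.exists_eq_add_of_le hkh
  rw [gPoly_eq_gammaOfDegree hk hkh, coeff_gammaOfDegree, Nat.add_sub_cancel_left]
  split_ifs with hl
  · rw [cast_gammaCoeff_relaxZ m _ hk, if_neg (by omega), Nat.add_sub_cancel]
  · rw [relaxGamma_eq_zero m hk (by omega), Int.cast_zero]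

theorem coeff_gPoly_nonneg {k h : ℕ} (hk : 1 ≤ k) (hkh : k ≤ h) (i : ℕ) :
    0 ≤ (gPoly k h).coeff i := by
  rcases i with _ | l
  · exact (coeff_zero_gPoly hk hkh).ge
  · have hnonneg := relaxGamma_nonneg l (h - k) k
    rw [← cast_coeff_succ_gPoly hk hkh] at hnonneg
    exact_mod_cast hnonneg

theorem natDegree_gPoly {k h : ℕ} (hk : 1 ≤ k) (hkh : k ≤ h) : (gPoly k h).natDegree = k / 2 := by
  refine le_antisymm (natDegree_le_iff_coeff_eq_zero.2 fun i hi => ?_) ?_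
  · obtain ⟨l, rfl⟩ := Nat.exists_eq_add_of_lt (Nat.zero_lt_of_lt hi)
    have hcoeff := cast_coeff_succ_gPoly hk hkh (0 + l)
    rw [relaxGamma_eq_zero _ hk (by omega)] at hcoeff
    exact_mod_cast hcoeff
  · rcases hk2 : k / 2 with _ | l
    · exact Nat.zero_le _
    · refine le_natDegree_of_ne_zero fun hzero => ?_
      have hpos := relaxGamma_pos (h - k) (by omega : 2 * l + 2 ≤ k)
      rw [← cast_coeff_succ_gPoly hk hkh, hzero, Int.cast_zero] at hpos
      exact hpos.false

end PavingMatroid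

open PavingMatroid

theorem theorem1p6 :
    (∀ (α : Type*) (M : Matroid α) [M.Finite] (k n : ℕ),
      M.IsPaving → M.eRank = k → M.E.encard = n →
        M.gamma = (uniformMatroid k n).gamma -
          ∑ h ∈ Finset.Icc k n, M.numHyperplanes h • gPoly k h) ∧
    (∀ k h : ℕ, 1 ≤ k → k ≤ h →
      (∀ i, 0 ≤ (gPoly k h).coeff i) ∧ (gPoly k h).natDegree = k / 2) := by
  refine ⟨fun α M _ k n hM hk hn => ?_, fun k h hk hkh =>
    ⟨coeff_gPoly_nonneg hk hkh, natDegree_gPoly hk hkh⟩⟩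
  obtain rfl : M.natRank = k := by exact_mod_cast (cast_natRank M).trans hk
  obtain rfl : M.E.ncard = n := by rw [Set.ncard, hn, ENat.toNat_natCast]
  exact gamma_eq_sub_sum_of_isPaving hM
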